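/- Let $b\in\mathbb C$ with $\operatorname{Re} b>0$ and $\operatorname{Im}(b^2)>0$, and put $q=e^{2\pi i b^2}$, $\tilde q=e^{-2\pi i b^{-2}}$, $c_b=\frac i2(b+b^{-1})$, and $\left(q/\tilde q\right)^{1/24}=e^{2\pi i(b^2+b^{-2})/24}$. Write $(a;q)_\infty=\prod_{k\ge0}(1-aq^k)$, $(q)_n=\prod_{k=1}^n(1-q^k)$, and let $$\Phi_b(x)=\frac{(e^{2\pi b(x+c_b)};q)_\infty}{(e^{2\pi b^{-1}(x-c_b)};\tilde q)_\infty}$$ be Faddeev's quantum dilogarithm. For the $4_1$ knot, $(A,B)=(1,2)$, let $$\mathcal I_{4_1}(b)=\int_{\mathbb R+i\epsilon}\Phi_b(x)^2e^{-\pi i x^2}\,dx .$$ For $|q|<1$ let $$F(q,x)=\sum_{n=0}^\infty(-1)^n\frac{q^{n(n+1)/2}}{(q)_n^2}x^n,\qquad g(q)=\sum_{n=0}^\infty(-1)^n\frac{q^{n(n+1)/2}}{(q)_n^2},$$ $$G(q)=\sum_{m=0}^\infty\Bigl(1+2m-4\sum_{s=1}^\infty\frac{q^{s(m+1)}}{1-q^s}\Bigr)(-1)^m\frac{q^{m(m+1)/2}}{(q)_m^2}.$$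 For a function $f$ of $x$ let $(\delta f)(x)=x f'(x)$, $(\delta_1f)(x)=\sum_{s\ge1}\frac{q^s}{1-q^s}f(q^sx)$ and $\langle f\rangle=f(1)$. Then: (a) For every $b$ as above and every $\epsilon$ with $0<\epsilon<\operatorname{Im}c_b$ the integral $\mathcal I_{4_1}(b)$ converges absolutely and $$\mathcal I_{4_1}(b)=-\frac i2\left(\frac q{\tilde q}\right)^{1/24}\left(b\,G(q)g(\tilde q)-b^{-1}G(\tilde q)g(q)\right).$$ (b) For every $q\in\mathbb C$ with $|q|<1$, the function $F(q,\cdot)$ is entire, all the series above (including the one for $(\delta_1F)(x)$, for every $x\in\mathbb C$) converge absolutely, and $$g(q)=\langle F\rangle,\qquad G(q)=\langle(1+2\delta-4\delta_1)F\rangle .$$ (c) $F$ satisfies the linear $q$-difference equation $$F(q,q^{-1}x)+F(q,qx)=(2-x)F(q,x),$$ both for all complex $q,x$ with $0<|q|<1$ and as an identity of formal power series in $\mathbb Q(q)[[x]]$. -/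

import Mathlib

open Complex MeasureTheory

noncomputable section

namespace KnotStateIntegral

/-- The infinite `q`-Pochhammer symbol `(a;q)_∞ = ∏_{k ≥ 0} (1 - a q^k)`, for `|q| < 1`. -/
def qPochInf (a q : ℂ) : ℂ := ∏' k : ℕ, (1 - a * q ^ k)

/-- The infinite product defining `(a;q)_∞` converges for `|q| < 1`. -/
theorem multipliable_qPochInf (a q : ℂ) (hq : ‖q‖ < 1) :
    Multipliable (fun k : ℕ => 1 - a * q ^ k) := by
  have h : Summable (fun k : ℕ => ‖-(a * q ^ k)‖) := by
    simpa [norm_mul, norm_pow] using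
      (summable_geometric_of_lt_one (norm_nonneg q) hq).mul_left ‖a‖
  simpa [sub_eq_add_neg] using multipliable_one_add_of_summable h

/-- The finite `q`-Pochhammer symbol `(q)_m = (1 - q)(1 - q^2) ⋯ (1 - q^m)`. -/
def qPoch {K : Type*} [Field K] (q : K) (m : ℕ) : K :=
  ∏ k ∈ Finset.range m, (1 - q ^ (k + 1))

/-- `q = exp(2πi b²)`. -/
def nome (b : ℂ) : ℂ := exp (2 * Real.pi * I * b ^ 2)

/-- `q̃ = exp(-2πi b⁻²)`. -/
def dualNome (b : ℂ) : ℂ := exp (-(2 * Real.pi * I * (b ^ 2)⁻¹))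

/-- `c_b = (i/2)(b + b⁻¹)`. -/
def cb (b : ℂ) : ℂ := I / 2 * (b + b⁻¹)

/-- The fractional power `(q/q̃)^r = exp(2πi r (b² + b⁻²))`, with the branch fixed by `b`. -/
def nomeRatioPow (b r : ℂ) : ℂ := exp (2 * Real.pi * I * r * (b ^ 2 + (b ^ 2)⁻¹))

/-- Faddeev's quantum dilogarithm `Φ_b(x)` for `Im(b²) > 0`. The quotient takes the value `0` at its
poles and at the (isolated) removable points where numerator and denominator both vanish; on a
horizontal line these form a countable set, so integrals are not affected. -/
def faddeev (b x : ℂ) : ℂ :=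
  qPochInf (exp (2 * Real.pi * b * (x + cb b))) (nome b) /
    qPochInf (exp (2 * Real.pi * b⁻¹ * (x - cb b))) (dualNome b)

/-- `Φ_b(x)^B exp(-A π i x²)`. -/
def stateIntegrand (A B : ℕ) (b x : ℂ) : ℂ :=
  faddeev b x ^ B * exp (-(A * Real.pi * I * x ^ 2))

/-- The state integral `∫_{ℝ + iε} Φ_b(x)^B exp(-A π i x²) dx`. -/
def stateIntegral (A B : ℕ) (b : ℂ) (ε : ℝ) : ℂ :=
  ∫ t : ℝ, stateIntegrand A B b (t + I * ε)

/-- The coefficient `(-1)^{Am} q^{A m(m+1)/2} / (q)_m^B` of `x^m` in `F_{A,B}(q,x)`. -/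
def coeffAB {K : Type*} [Field K] (A B : ℕ) (q : K) (m : ℕ) : K :=
  (-1) ^ (A * m) * q ^ (A * (m * (m + 1) / 2)) / qPoch q m ^ B

/-- `F_{A,B}(q,x)` as a formal power series in `x`. -/
def formalAB {K : Type*} [Field K] (A B : ℕ) (q : K) : PowerSeries K :=
  PowerSeries.mk (coeffAB A B q)

/-- `F_{A,B}(q,x)` as a function of complex `q`, `x`. -/
def seriesAB (A B : ℕ) (q x : ℂ) : ℂ := ∑' m : ℕ, coeffAB A B q m * x ^ m

/-- The operator `(δ f)(x) = x f'(x)`. -/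
def opDelta (f : ℂ → ℂ) (x : ℂ) : ℂ := x * deriv f x

/-- The operator `(δ_k f)(x) = ∑_{s ≥ 1} s^{k-1} q^s / (1 - q^s) f(q^s x)`, for `k ≥ 1`. -/
def opDeltaK (q : ℂ) (k : ℕ) (f : ℂ → ℂ) (x : ℂ) : ℂ :=
  ∑' s : ℕ, ((s + 1 : ℕ) : ℂ) ^ (k - 1) * q ^ (s + 1) / (1 - q ^ (s + 1)) * f (q ^ (s + 1) * x)

/-- `⟨f⟩ = f(1)`. -/
def bracket (f : ℂ → ℂ) : ℂ := f 1

/-- The `n`-th term `(-1)^n q^{n(n+1)/2} / (q)_n²`. -/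
def term41 (q : ℂ) (n : ℕ) : ℂ := (-1) ^ n * q ^ (n * (n + 1) / 2) / qPoch q n ^ 2

/-- `g(q) = ∑_{n ≥ 0} (-1)^n q^{n(n+1)/2} / (q)_n²`. -/
def g41 (q : ℂ) : ℂ := ∑' n : ℕ, term41 q n

/-- `1 + 2m - 4 ∑_{s ≥ 1} q^{s(m+1)} / (1 - q^s)`. -/
def weight41 (q : ℂ) (m : ℕ) : ℂ :=
  1 + 2 * m - 4 * ∑' s : ℕ, q ^ ((s + 1) * (m + 1)) / (1 - q ^ (s + 1))

/-- `G(q) = ∑_{m ≥ 0} (1 + 2m - 4 ∑_{s ≥ 1} q^{s(m+1)}/(1-q^s)) (-1)^m q^{m(m+1)/2} / (q)_m²`. -/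
def G41 (q : ℂ) : ℂ := ∑' m : ℕ, weight41 q m * term41 q m

end KnotStateIntegral

end

open KnotStateIntegral

namespace KnotStateIntegral

open Filter Topology

/-! ### The infinite `q`-Pochhammer symbol -/

/-! Write u = exp(2πb(x + c_b)) and v = exp(2πb⁻¹(x - c_b)), so that the integrand is f = exp(-πix²)
(u;q)_∞² / (v;q̃)_∞². The shift x ↦ x + ib multiplies u by q, fixes v and multiplies the Gaussian by
-u; the shift by ib⁻¹ plays the dual role. The entire function D(q,u) = `entireBlock q u` solves
D(q,u) + u D(q,uq) = (u;q)_∞² (`entireBlock_step`), so replacing (u;q)_∞² by D(q,u) in f gives a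
function k with f(x) = k(x) - k(x + ib).

The contour is cut at a point P on the ray through c_b. The left half is rotated to the direction
ib, where f telescopes and only one period of k remains (`integral_left`). On the right half the
inversion relation (`exists_inversion`, from Liouville's theorem) rewrites f, up to a constant K²,
in terms of q/u and q̃/v; it is rotated to the direction ib⁻¹ and telescopes there with D(q̃, q̃/v)
(`integral_right`). Both segments are differences of one function, `blockIntegrand` = exp(-πix²)
D(q,u) D(q̃,q̃/v) / θ² with θ = (v;q̃)_∞ (q̃/v;q̃)_∞, and together they form its integral over the
boundary of a period parallelogram (`stateIntegral_eq_boundary`). K drops out again and is never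
computed.

The only pole inside is a double pole at c_b, where u = q and q̃/v = q̃. There D(q,q) = (q;q)_∞²
g(q) and D + 2q ∂D/∂u = (q;q)_∞² G(q) (`entireBlock_self`, `self_mul_deriv_entireBlock`), so the
residue is bilinear in g and G (`residue_value`). The remaining factor (q;q)_∞² / (q̃;q̃)_∞² is
evaluated by the modularity of the Dedekind eta function (`qPochInf_sq_modular`).

Part (b) is termwise application of the operators to the superexponentially convergent series F, and
part (c) is the two-term recursion of its coefficients, valid over any field
(`coeffAB_one_two_succ`). -/

theorem summable_norm_mul_pow (a : ℂ) {q : ℂ} (hq : ‖q‖ < 1) :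
    Summable (fun k : ℕ => ‖-(a * q ^ k)‖) := by
  simpa [norm_mul, norm_pow] using
    (summable_geometric_of_lt_one (norm_nonneg q) hq).mul_left ‖a‖

theorem qPochInf_step (a : ℂ) {q : ℂ} (hq : ‖q‖ < 1) :
    qPochInf a q = (1 - a) * qPochInf (a * q) q := by
  have h := multipliable_qPochInf (a * q) q hq
  unfold qPochInf
  rw [tprod_eq_zero_mul' (f := fun k : ℕ => 1 - a * q ^ k)
    (by simpa only [pow_succ', mul_assoc] using h)]
  simp only [pow_zero, mul_one, pow_succ', mul_assoc]

theorem qPochInf_ne_zero {a q : ℂ} (hq : ‖q‖ < 1) (h : ∀ k : ℕ, 1 - a * q ^ k ≠ 0) :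
    qPochInf a q ≠ 0 := by
  unfold qPochInf
  simp only [sub_eq_add_neg] at h ⊢
  exact tprod_one_add_ne_zero_of_summable h (summable_norm_mul_pow a hq)

theorem one_sub_mul_pow_ne_zero {a q : ℂ} (hq : ‖q‖ < 1) (ha : ‖a‖ < 1) (k : ℕ) :
    1 - a * q ^ k ≠ 0 := by
  intro h
  have h1 : ‖a * q ^ k‖ = 1 := by rw [← sub_eq_zero.mp h, norm_one]
  rw [norm_mul, norm_pow] at h1
  have h2 : ‖q‖ ^ k ≤ 1 := pow_le_one₀ (norm_nonneg q) hq.le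
  nlinarith [norm_nonneg a, pow_nonneg (norm_nonneg q) k]

theorem qPochInf_ne_zero_of_norm_lt_one {a q : ℂ} (hq : ‖q‖ < 1) (ha : ‖a‖ < 1) :
    qPochInf a q ≠ 0 :=
  qPochInf_ne_zero hq (one_sub_mul_pow_ne_zero hq ha)

theorem exists_of_qPochInf_eq_zero {a q : ℂ} (hq : ‖q‖ < 1) (h : qPochInf a q = 0) :
    ∃ k : ℕ, a * q ^ k = 1 := by
  by_contra! H
  exact qPochInf_ne_zero hq (fun k hk => H k (sub_eq_zero.mp hk).symm) h

theorem multipliableLocallyUniformlyOn_qPochInf {q : ℂ} (hq : ‖q‖ < 1) (R : ℝ) :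
    MultipliableLocallyUniformlyOn (fun (k : ℕ) a => 1 - a * q ^ k) (Metric.ball (0 : ℂ) R) := by
  simp_rw [sub_eq_add_neg]
  refine Summable.multipliableLocallyUniformlyOn_nat_one_add Metric.isOpen_ball
    ((summable_geometric_of_lt_one (norm_nonneg q) hq).mul_left R)
    (.of_forall fun n x hx => ?_) (fun n => by fun_prop)
  rw [norm_neg, norm_mul, norm_pow]
  exact mul_le_mul_of_nonneg_right (mem_ball_zero_iff.mp hx).le (by positivity)

theorem differentiable_qPochInf {q : ℂ} (hq : ‖q‖ < 1) :
    Differentiable ℂ (fun a => qPochInf a q) := by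
  intro a
  have h : DifferentiableOn ℂ (fun a => qPochInf a q) (Metric.ball 0 (‖a‖ + 1)) :=
    (multipliableLocallyUniformlyOn_qPochInf hq _).hasProdLocallyUniformlyOn.differentiableOn
      (.of_forall fun _ => by simpa [Finset.prod_fn] using
        DifferentiableOn.finsetProd (fun _ _ => by fun_prop)) Metric.isOpen_ball
  exact h.differentiableAt (Metric.isOpen_ball.mem_nhds (by simp))

/-- Locally uniform convergence of the product allows termwise logarithmic differentiation. At a =
q^{m+1} the resulting sum is the source of the Lambert series in G. -/
theorem logDeriv_qPochInf {a q : ℂ} (hq : ‖q‖ < 1) (ha : ‖a‖ < 1) :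
    logDeriv (fun a => qPochInf a q) a = ∑' k : ℕ, -(q ^ k / (1 - a * q ^ k)) := by
  have hterm : ∀ k : ℕ, logDeriv (fun a => 1 - a * q ^ k) a = -(q ^ k / (1 - a * q ^ k)) := by
    intro k
    rw [logDeriv_apply]
    have : HasDerivAt (fun a : ℂ => 1 - a * q ^ k) (-(1 * q ^ k)) a :=
      ((hasDerivAt_id a).mul_const _).const_sub 1
    rw [this.deriv]; ring
  have hpos : 0 < 1 - ‖a‖ := by linarith
  have := logDeriv_tprod_eq_tsum (s := Metric.ball (0 : ℂ) 1) (x := a)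
    (f := fun (k : ℕ) a => 1 - a * q ^ k) Metric.isOpen_ball (by simpa using ha)
    (one_sub_mul_pow_ne_zero hq ha) (fun k => by fun_prop) ?_
    (multipliableLocallyUniformlyOn_qPochInf hq 1) (qPochInf_ne_zero_of_norm_lt_one hq ha)
  · simp only [hterm] at this
    exact this
  · simp only [hterm]
    refine Summable.of_norm_bounded
      ((summable_geometric_of_lt_one (norm_nonneg q) hq).mul_right (1 - ‖a‖)⁻¹) fun k => ?_
    rw [norm_neg, norm_div, norm_pow, div_eq_mul_inv]
    gcongr
    calc 1 - ‖a‖ ≤ 1 - ‖a * q ^ k‖ := by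
          rw [norm_mul, norm_pow]
          have h2 : ‖q‖ ^ k ≤ 1 := pow_le_one₀ (norm_nonneg q) hq.le
          nlinarith [norm_nonneg a]
      _ ≤ ‖1 - a * q ^ k‖ := by simpa using norm_sub_norm_le 1 (a * q ^ k)

theorem qPochInf_eq_qPoch_mul {q : ℂ} (hq : ‖q‖ < 1) (m : ℕ) :
    qPochInf q q = qPoch q m * qPochInf (q * q ^ m) q := by
  induction m with
  | zero => simp [qPoch]
  | succ m ih =>
    rw [ih, qPochInf_step _ hq, qPoch, qPoch, Finset.prod_range_succ]
    ring_nf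

theorem one_sub_pow_succ_ne_zero {q : ℂ} (hq : ‖q‖ < 1) (k : ℕ) : 1 - q ^ (k + 1) ≠ 0 := by
  simpa [pow_succ'] using one_sub_mul_pow_ne_zero hq hq k

theorem qPoch_ne_zero {q : ℂ} (hq : ‖q‖ < 1) (m : ℕ) : qPoch q m ≠ 0 :=
  Finset.prod_ne_zero_iff.mpr fun k _ => one_sub_pow_succ_ne_zero hq k

theorem norm_one_sub_pow_ge {q : ℂ} (hq : ‖q‖ < 1) (k : ℕ) : 1 - ‖q‖ ≤ ‖1 - q ^ (k + 1)‖ :=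
  calc 1 - ‖q‖ ≤ 1 - ‖q ^ (k + 1)‖ := by
        rw [norm_pow, pow_succ']
        have h2 : ‖q‖ ^ k ≤ 1 := pow_le_one₀ (norm_nonneg q) hq.le
        nlinarith [norm_nonneg q]
    _ ≤ ‖1 - q ^ (k + 1)‖ := by simpa using norm_sub_norm_le 1 (q ^ (k + 1))

theorem norm_qPoch_ge {q : ℂ} (hq : ‖q‖ < 1) (m : ℕ) : (1 - ‖q‖) ^ m ≤ ‖qPoch q m‖ := by
  rw [qPoch, norm_prod]
  calc (1 - ‖q‖) ^ m = ∏ _k ∈ Finset.range m, (1 - ‖q‖) := by simp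
    _ ≤ _ := Finset.prod_le_prod (fun _ _ => by linarith) fun k _ => norm_one_sub_pow_ge hq k

/-! ### Superexponentially convergent series -/

theorem triangle_succ (m : ℕ) : (m + 1) * (m + 1 - 1) / 2 = m * (m - 1) / 2 + m := by
  rcases m with _ | m
  · simp
  · simp only [Nat.add_sub_cancel]
    rw [show (m + 1 + 1) * (m + 1) = (m + 1) * m + (m + 1) * 2 by ring,
      Nat.add_mul_div_right _ _ (by norm_num)]

theorem triangle_succ_eq (m : ℕ) : m * (m + 1) / 2 = m * (m - 1) / 2 + m := by
  rw [← triangle_succ, Nat.add_sub_cancel, mul_comm]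

/-- Ratio test: consecutive terms have ratio R r^m, which tends to 0 for every R. This one majorant
serves both `entireBlock` and F. -/
theorem summable_pow_mul_pow_triangle (R : ℝ) {r : ℝ} (hr0 : 0 ≤ r) (hr : r < 1) :
    Summable (fun m : ℕ => R ^ m * r ^ (m * (m - 1) / 2)) := by
  refine summable_of_ratio_norm_eventually_le (r := 1 / 2) (by norm_num) ?_
  have h : Tendsto (fun m : ℕ => |R| * r ^ m) atTop (𝓝 0) := by
    simpa using (tendsto_pow_atTop_nhds_zero_of_lt_one hr0 hr).const_mul |R|
  filter_upwards [h.eventually (gt_mem_nhds (show (0 : ℝ) < 1 / 2 by norm_num))] with m hm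
  rw [triangle_succ, pow_succ, pow_add]
  rw [show R ^ m * R * (r ^ (m * (m - 1) / 2) * r ^ m) =
    (R * r ^ m) * (R ^ m * r ^ (m * (m - 1) / 2)) by ring, norm_mul]
  refine mul_le_mul_of_nonneg_right ?_ (norm_nonneg _)
  rw [norm_mul, Real.norm_eq_abs, norm_pow, Real.norm_of_nonneg hr0]
  exact hm.le

/-! ### The entire function `(u;q)_∞² ∑ (-1)^m u^m q^{m(m-1)/2} / (u;q)_m²` -/

/-- The `m`-th term of `entireBlock`. -/
noncomputable def blockTerm (q : ℂ) (m : ℕ) (u : ℂ) : ℂ :=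
  (-1) ^ m * u ^ m * q ^ (m * (m - 1) / 2) * qPochInf (u * q ^ m) q ^ 2

/-- The entire function `∑_m (-1)^m u^m q^{m(m-1)/2} (u q^m;q)_∞²` of `u`. -/
noncomputable def entireBlock (q u : ℂ) : ℂ := ∑' m : ℕ, blockTerm q m u

theorem differentiable_blockTerm {q : ℂ} (hq : ‖q‖ < 1) (m : ℕ) :
    Differentiable ℂ (blockTerm q m) := by
  have h : Differentiable ℂ (fun u => qPochInf (u * q ^ m) q) :=
    (differentiable_qPochInf hq).comp (differentiable_id.mul_const _)
  unfold blockTerm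
  fun_prop

theorem exists_blockTerm_bound {q : ℂ} (hq : ‖q‖ < 1) (R : ℝ) :
    ∃ B : ℕ → ℝ, Summable B ∧ ∀ m, ∀ u ∈ Metric.ball (0 : ℂ) R, ‖blockTerm q m u‖ ≤ B m := by
  -- Since |u q^m| ≤ |u|, one bound C on the disc of radius R controls the Pochhammer factor for all
  -- m at once.
  obtain ⟨C, hC⟩ := (isCompact_closedBall (0 : ℂ) R).exists_bound_of_continuousOn
    (differentiable_qPochInf hq).continuous.continuousOn
  refine ⟨fun m => R ^ m * ‖q‖ ^ (m * (m - 1) / 2) * C ^ 2,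
    (summable_pow_mul_pow_triangle R (norm_nonneg q) hq).mul_right _, fun m u hu => ?_⟩
  have hu' : ‖u‖ ≤ R := (mem_ball_zero_iff.mp hu).le
  have hR : 0 ≤ R := (norm_nonneg u).trans hu'
  have h1 : ‖qPochInf (u * q ^ m) q‖ ≤ C := by
    refine hC _ ?_
    rw [mem_closedBall_zero_iff, norm_mul, norm_pow]
    have h2 : ‖q‖ ^ m ≤ 1 := pow_le_one₀ (norm_nonneg q) hq.le
    nlinarith [norm_nonneg u]
  rw [blockTerm, norm_mul, norm_mul, norm_mul, norm_pow, norm_neg, norm_one, one_pow, one_mul,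
    norm_pow, norm_pow, norm_pow]
  change _ ≤ R ^ m * ‖q‖ ^ (m * (m - 1) / 2) * C ^ 2
  gcongr

theorem differentiable_entireBlock {q : ℂ} (hq : ‖q‖ < 1) : Differentiable ℂ (entireBlock q) := by
  intro u
  obtain ⟨B, hB, hle⟩ := exists_blockTerm_bound hq (‖u‖ + 1)
  exact (differentiableOn_tsum_of_summable_norm hB
    (fun m => (differentiable_blockTerm hq m).differentiableOn) Metric.isOpen_ball hle).differentiableAt
      (Metric.isOpen_ball.mem_nhds (by simp))

theorem summable_blockTerm {q : ℂ} (hq : ‖q‖ < 1) (u : ℂ) :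
    Summable (fun m => blockTerm q m u) := by
  obtain ⟨B, hB, hle⟩ := exists_blockTerm_bound hq (‖u‖ + 1)
  exact Summable.of_norm_bounded hB fun m => hle m u (by simp)

theorem hasSum_deriv_entireBlock {q : ℂ} (hq : ‖q‖ < 1) (u : ℂ) :
    HasSum (fun m => deriv (blockTerm q m) u) (deriv (entireBlock q) u) := by
  obtain ⟨B, hB, hle⟩ := exists_blockTerm_bound hq (‖u‖ + 1)
  exact hasSum_deriv_of_summable_norm hB
    (fun m => (differentiable_blockTerm hq m).differentiableOn) Metric.isOpen_ball hle (by simp)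

/-- Term m + 1 at u is -u times term m at uq, so the series telescopes down to its term m = 0. The
twist by u is the one that the Gaussian acquires under x ↦ x + ib. -/
theorem entireBlock_step {q : ℂ} (hq : ‖q‖ < 1) (u : ℂ) :
    entireBlock q u + u * entireBlock q (u * q) = qPochInf u q ^ 2 := by
  have h0 : blockTerm q 0 u = qPochInf u q ^ 2 := by simp [blockTerm]
  have h1 : ∀ m, blockTerm q (m + 1) u = -u * blockTerm q m (u * q) := by
    intro m
    simp only [blockTerm]
    rw [triangle_succ, mul_pow u q m, mul_assoc u q, ← pow_succ' q m]
    ring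
  unfold entireBlock
  rw [(summable_blockTerm hq u).tsum_eq_zero_add, h0]
  simp only [h1, tsum_mul_left]
  ring

theorem HasSum.of_forall_eq {f g : ℕ → ℂ} {a : ℂ} (h : ∀ m, f m = g m) (hf : HasSum f a) :
    HasSum g a := by
  rwa [← funext h]

/-! ### The series `F`, `g`, `G` -/

theorem coeffAB_one_two (q : ℂ) (m : ℕ) : coeffAB 1 2 q m = term41 q m := by
  simp [coeffAB, term41]

theorem seriesAB_one_two (q x : ℂ) : seriesAB 1 2 q x = ∑' m : ℕ, term41 q m * x ^ m := by
  simp [seriesAB, coeffAB_one_two]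

theorem norm_term41_mul_pow_le {q : ℂ} (hq : ‖q‖ < 1) {R : ℝ} {x : ℂ} (hx : ‖x‖ ≤ R) (m : ℕ) :
    ‖term41 q m * x ^ m‖ ≤ (R / (1 - ‖q‖) ^ 2) ^ m * ‖q‖ ^ (m * (m - 1) / 2) := by
  have hpos : 0 < 1 - ‖q‖ := by linarith
  have hR : 0 ≤ R := (norm_nonneg x).trans hx
  rw [term41, norm_mul, norm_div, norm_mul, norm_pow, norm_neg, norm_one, one_pow, one_mul,
    norm_pow, norm_pow, norm_pow, div_pow, ← pow_mul, mul_comm 2 m, pow_mul, div_mul_eq_mul_div,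
    div_mul_eq_mul_div, mul_comm (R ^ m)]
  -- Giving away a factor |q|^m brings the term under the majorant with triangular exponent
  -- m(m-1)/2.
  have h1 : ‖q‖ ^ (m * (m + 1) / 2) ≤ ‖q‖ ^ (m * (m - 1) / 2) :=
    pow_le_pow_of_le_one (norm_nonneg q) hq.le (by rw [triangle_succ_eq]; omega)
  have h2 := norm_qPoch_ge hq m
  gcongr

theorem summable_term41_mul_pow {q : ℂ} (hq : ‖q‖ < 1) (x : ℂ) :
    Summable (fun m : ℕ => term41 q m * x ^ m) :=
  Summable.of_norm_bounded (summable_pow_mul_pow_triangle _ (norm_nonneg q) hq)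
    (norm_term41_mul_pow_le hq le_rfl)

theorem summable_term41 {q : ℂ} (hq : ‖q‖ < 1) : Summable (term41 q) := by
  simpa using summable_term41_mul_pow hq 1

theorem hasSum_seriesAB {q : ℂ} (hq : ‖q‖ < 1) (x : ℂ) :
    HasSum (fun m : ℕ => term41 q m * x ^ m) (seriesAB 1 2 q x) := by
  rw [seriesAB_one_two]
  exact (summable_term41_mul_pow hq x).hasSum

theorem seriesAB_eq_tsum (q : ℂ) : seriesAB 1 2 q = fun x => ∑' m : ℕ, term41 q m * x ^ m :=
  funext fun x => seriesAB_one_two q x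

theorem differentiable_seriesAB {q : ℂ} (hq : ‖q‖ < 1) : Differentiable ℂ (seriesAB 1 2 q) := by
  intro x
  rw [seriesAB_eq_tsum]
  exact (differentiableOn_tsum_of_summable_norm
    (summable_pow_mul_pow_triangle _ (norm_nonneg q) hq) (fun m => by fun_prop)
    (Metric.isOpen_ball (x := (0 : ℂ)) (ε := ‖x‖ + 1))
    fun m u hu => norm_term41_mul_pow_le hq (mem_ball_zero_iff.mp hu).le m).differentiableAt
      (Metric.isOpen_ball.mem_nhds (by simp))

theorem hasSum_deriv_seriesAB {q : ℂ} (hq : ‖q‖ < 1) (x : ℂ) :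
    HasSum (fun m : ℕ => term41 q m * (m * x ^ (m - 1))) (deriv (seriesAB 1 2 q) x) := by
  rw [seriesAB_eq_tsum]
  have := hasSum_deriv_of_summable_norm (z := x)
    (F := fun (m : ℕ) x => term41 q m * x ^ m)
    (summable_pow_mul_pow_triangle _ (norm_nonneg q) hq) (fun m => by fun_prop)
    (Metric.isOpen_ball (x := (0 : ℂ)) (ε := ‖x‖ + 1))
    (fun m u hu => norm_term41_mul_pow_le hq (mem_ball_zero_iff.mp hu).le m) (by simp)
  simpa using this

/-- The Lambert coefficients `q^s / (1 - q^s)`, `s ≥ 1`, are dominated by a geometric series. -/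
theorem norm_lambert_le {q : ℂ} (hq : ‖q‖ < 1) (s : ℕ) :
    ‖q ^ (s + 1) / (1 - q ^ (s + 1))‖ ≤ ‖q‖ ^ s * (1 - ‖q‖)⁻¹ := by
  have hpos : 0 < 1 - ‖q‖ := by linarith
  rw [norm_div, norm_pow, div_eq_mul_inv]
  have h1 : ‖q‖ ^ (s + 1) ≤ ‖q‖ ^ s :=
    pow_le_pow_of_le_one (norm_nonneg q) hq.le (Nat.le_succ s)
  have h2 := norm_one_sub_pow_ge hq s
  gcongr

theorem summable_lambert_bound {q : ℂ} (hq : ‖q‖ < 1) :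
    Summable (fun s : ℕ => ‖q‖ ^ s * (1 - ‖q‖)⁻¹) :=
  (summable_geometric_of_lt_one (norm_nonneg q) hq).mul_right _

theorem summable_lambert_mul {q : ℂ} (hq : ‖q‖ < 1) {f : ℕ → ℂ} {C : ℝ} (hf : ∀ s, ‖f s‖ ≤ C) :
    Summable (fun s : ℕ => q ^ (s + 1) / (1 - q ^ (s + 1)) * f s) := by
  refine Summable.of_norm_bounded ((summable_lambert_bound hq).mul_right C) fun s => ?_
  rw [norm_mul]
  exact mul_le_mul (norm_lambert_le hq s) (hf s) (norm_nonneg _)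
    ((norm_nonneg _).trans (norm_lambert_le hq s))

theorem pow_div_eq_lambert_mul (q : ℂ) (m s : ℕ) :
    q ^ ((s + 1) * (m + 1)) / (1 - q ^ (s + 1)) =
      q ^ (s + 1) / (1 - q ^ (s + 1)) * q ^ ((s + 1) * m) := by
  rw [show (s + 1) * (m + 1) = (s + 1) + (s + 1) * m by ring, pow_add]
  ring

theorem norm_pow_le_one {q : ℂ} (hq : ‖q‖ < 1) (k : ℕ) : ‖q ^ k‖ ≤ 1 := by
  rw [norm_pow]
  exact pow_le_one₀ (norm_nonneg q) hq.le

theorem summable_lambert {q : ℂ} (hq : ‖q‖ < 1) (m : ℕ) :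
    Summable (fun s : ℕ => q ^ ((s + 1) * (m + 1)) / (1 - q ^ (s + 1))) := by
  simp only [pow_div_eq_lambert_mul]
  exact summable_lambert_mul hq fun s => norm_pow_le_one hq _

theorem summable_opDeltaK_one {q : ℂ} (hq : ‖q‖ < 1) (x : ℂ) :
    Summable (fun s : ℕ =>
      q ^ (s + 1) / (1 - q ^ (s + 1)) * seriesAB 1 2 q (q ^ (s + 1) * x)) := by
  obtain ⟨C, hC⟩ := (isCompact_closedBall (0 : ℂ) ‖x‖).exists_bound_of_continuousOn
    (differentiable_seriesAB hq).continuous.continuousOn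
  refine summable_lambert_mul hq fun s => hC _ ?_
  rw [mem_closedBall_zero_iff, norm_mul]
  exact mul_le_of_le_one_left (norm_nonneg x) (norm_pow_le_one hq _)

theorem summable_double_lambert {q : ℂ} (hq : ‖q‖ < 1) :
    Summable (fun p : ℕ × ℕ =>
      q ^ ((p.2 + 1) * (p.1 + 1)) / (1 - q ^ (p.2 + 1)) * term41 q p.1) := by
  have h := Summable.mul_of_nonneg (summable_term41 hq).norm (summable_lambert_bound hq)
    (fun _ => norm_nonneg _) fun s => (norm_nonneg _).trans (norm_lambert_le hq s)
  refine Summable.of_norm_bounded h fun p => ?_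
  rw [norm_mul, mul_comm, pow_div_eq_lambert_mul, norm_mul]
  refine mul_le_mul_of_nonneg_left ?_ (norm_nonneg _)
  exact (mul_le_of_le_one_right (norm_nonneg _) (norm_pow_le_one hq _)).trans
    (norm_lambert_le hq _)

theorem opDelta_seriesAB_one {q : ℂ} (hq : ‖q‖ < 1) :
    HasSum (fun m : ℕ => m * term41 q m) (opDelta (seriesAB 1 2 q) 1) := by
  simpa [opDelta, mul_comm] using hasSum_deriv_seriesAB hq 1

/-- Fubini for the absolutely convergent double series over s and m: summing over m first gives δ₁F
at 1, summing over s first gives the Lambert sums in the weight. -/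
theorem opDeltaK_seriesAB_one {q : ℂ} (hq : ‖q‖ < 1) :
    HasSum (fun m : ℕ => (∑' s : ℕ, q ^ ((s + 1) * (m + 1)) / (1 - q ^ (s + 1))) * term41 q m)
      (opDeltaK q 1 (seriesAB 1 2 q) 1) := by
  obtain ⟨f, hf⟩ : ∃ f : ℕ × ℕ → ℂ, ∀ m s, f (m, s) =
      q ^ ((s + 1) * (m + 1)) / (1 - q ^ (s + 1)) * term41 q m := 
    ⟨fun p => q ^ ((p.2 + 1) * (p.1 + 1)) / (1 - q ^ (p.2 + 1)) * term41 q p.1, fun _ _ => rfl⟩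
  have hd : Summable f := (summable_double_lambert hq).congr fun p => (hf p.1 p.2).symm
  have h1 : HasSum (fun m => ∑' s, f (m, s)) (∑' p, f p) := by
    rw [hd.tsum_prod]
    exact hd.prod.hasSum
  have h2 : ∑' p, f p = opDeltaK q 1 (seriesAB 1 2 q) 1 := by
    have hd' : Summable fun p : ℕ × ℕ => f p.swap := (Equiv.prodComm ℕ ℕ).summable_iff.mpr hd
    rw [← (Equiv.prodComm ℕ ℕ).tsum_eq f]
    simp only [Equiv.prodComm_apply]
    rw [hd'.tsum_prod]
    unfold opDeltaK
    refine tsum_congr fun s => ?_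
    rw [seriesAB_one_two, ← tsum_mul_left]
    refine tsum_congr fun m => ?_
    rw [Prod.swap_prod_mk, hf, pow_div_eq_lambert_mul, mul_one, ← pow_mul]
    simp only [Nat.sub_self, pow_zero, one_mul]
    ring
  rw [← h2]
  refine HasSum.of_forall_eq (fun m => ?_) h1
  simp only [hf, tsum_mul_right]

theorem hasSum_weight41 {q : ℂ} (hq : ‖q‖ < 1) :
    HasSum (fun m : ℕ => weight41 q m * term41 q m)
      (seriesAB 1 2 q 1 + 2 * opDelta (seriesAB 1 2 q) 1
        - 4 * opDeltaK q 1 (seriesAB 1 2 q) 1) := by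
  have h0 : HasSum (term41 q) (seriesAB 1 2 q 1) := by simpa using hasSum_seriesAB hq 1
  refine HasSum.of_forall_eq (fun m => ?_) ((h0.add ((opDelta_seriesAB_one hq).mul_left 2)).sub
    ((opDeltaK_seriesAB_one hq).mul_left 4))
  simp only [weight41]
  ring

/-! ### The `q`-difference equation -/

/-- With n = m + 1, the identity q⁻ⁿ + qⁿ - 2 = q⁻ⁿ(1 - qⁿ)² cancels exactly the ratio -qⁿ/(1 - qⁿ)²
of consecutive coefficients. A general field covers both complex q and the indeterminate. -/
theorem coeffAB_one_two_succ {K : Type*} [Field K] {q : K} (hq : q ≠ 0)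
    (h : ∀ k : ℕ, 1 - q ^ (k + 1) ≠ 0) (m : ℕ) :
    (q⁻¹ ^ (m + 1) + q ^ (m + 1)) * coeffAB 1 2 q (m + 1) =
      2 * coeffAB 1 2 q (m + 1) - coeffAB 1 2 q m := by
  have h1 : qPoch q (m + 1) = qPoch q m * (1 - q ^ (m + 1)) := Finset.prod_range_succ _ _
  have h2 : qPoch q m ≠ 0 := Finset.prod_ne_zero_iff.mpr fun k _ => h k
  have h3 := h m
  have h4 : (m + 1) * (m + 1 + 1) / 2 = m * (m + 1) / 2 + (m + 1) := by
    have := triangle_succ (m + 1)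
    simpa [mul_comm] using this
  have h5 : q ^ (m + 1) ≠ 0 := pow_ne_zero _ hq
  simp only [coeffAB, one_mul]
  rw [h1, h4, pow_add q (m * (m + 1) / 2) (m + 1), pow_succ (-1 : K), inv_pow]
  generalize q ^ (m + 1) = t at *
  field_simp
  ring

theorem coeffAB_zero {K : Type*} [Field K] (A B : ℕ) (q : K) : coeffAB A B q 0 = 1 := by
  simp [coeffAB, qPoch]

theorem seriesAB_qDifference {q : ℂ} (hq0 : q ≠ 0) (hq : ‖q‖ < 1) (x : ℂ) :
    seriesAB 1 2 q (q⁻¹ * x) + seriesAB 1 2 q (q * x) = (2 - x) * seriesAB 1 2 q x := by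
  have h0 := fun y => (hasSum_seriesAB hq y).summable
  have e1 := (hasSum_seriesAB hq (q⁻¹ * x)).add (hasSum_seriesAB hq (q * x))
  have e2 := (hasSum_seriesAB hq x).mul_left 2
  have e3 : HasSum (fun m : ℕ => if m = 0 then 0 else term41 q (m - 1) * x ^ m)
      (x * seriesAB 1 2 q x) := by
    rw [← hasSum_nat_add_iff' 1]
    simpa [pow_succ, mul_comm, mul_left_comm, mul_assoc] using (hasSum_seriesAB hq x).mul_left x
  rw [sub_mul]
  refine e1.unique ?_
  refine HasSum.of_forall_eq (fun m => ?_) (e2.sub e3)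
  rcases m with _ | m
  · simp; ring
  · have := coeffAB_one_two_succ hq0 (one_sub_pow_succ_ne_zero hq) m
    simp only [coeffAB_one_two] at this
    simp only [mul_pow, Nat.succ_ne_zero, if_false, Nat.add_sub_cancel]
    linear_combination -x ^ (m + 1) * this

theorem formalAB_qDifference :
    PowerSeries.rescale (RatFunc.X : RatFunc ℚ)⁻¹ (formalAB 1 2 RatFunc.X) +
        PowerSeries.rescale (RatFunc.X : RatFunc ℚ) (formalAB 1 2 RatFunc.X) =
      (2 - PowerSeries.X) * formalAB 1 2 (RatFunc.X : RatFunc ℚ) := by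
  have hX : ∀ k : ℕ, 1 - (RatFunc.X : RatFunc ℚ) ^ (k + 1) ≠ 0 := by
    intro k h
    have h1 : algebraMap (Polynomial ℚ) (RatFunc ℚ) (1 - Polynomial.X ^ (k + 1)) = 0 := by
      simpa using h
    rw [map_eq_zero_iff _ (RatFunc.algebraMap_injective ℚ)] at h1
    -- The polynomial 1 - X^{k+1} takes the value 1 at 0, hence is not zero.
    have := congrArg (Polynomial.eval 0) h1
    simp at this
  have h2 : (2 : PowerSeries (RatFunc ℚ)) = PowerSeries.C 2 := (map_ofNat PowerSeries.C 2).symm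
  ext m
  rw [sub_mul, h2]
  simp only [map_add, map_sub, PowerSeries.coeff_rescale, PowerSeries.coeff_C_mul, formalAB,
    PowerSeries.coeff_mk]
  rcases m with _ | m
  · simp [coeffAB_zero]; norm_num
  · rw [PowerSeries.coeff_succ_X_mul, PowerSeries.coeff_mk, ← add_mul]
    exact coeffAB_one_two_succ RatFunc.X_ne_zero hX m

/-! ### Values of the entire block and of its derivative at `u = q` -/

/-- Both sides expand geometrically into the double series of q^{(m+1+k)(s+1)}, summed in the two
possible orders. -/
theorem tsum_lambert_swap {q : ℂ} (hq : ‖q‖ < 1) (m : ℕ) :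
    ∑' k : ℕ, q ^ (m + 1 + k) / (1 - q ^ (m + 1 + k)) =
      ∑' s : ℕ, q ^ ((s + 1) * (m + 1)) / (1 - q ^ (s + 1)) := by
  have hgeo : ∀ k : ℕ, ∀ z : ℂ, HasSum (fun s : ℕ => z * (q ^ (k + 1)) ^ s)
      (z / (1 - q ^ (k + 1))) := by
    intro k z
    rw [div_eq_mul_inv]
    refine (hasSum_geometric_of_norm_lt_one ?_).mul_left z
    rw [norm_pow]
    exact pow_lt_one₀ (norm_nonneg q) hq (Nat.succ_ne_zero k)
  obtain ⟨f, hf⟩ : ∃ f : ℕ × ℕ → ℂ, ∀ k s, f (k, s) = q ^ ((m + 1 + k) * (s + 1)) :=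
    ⟨fun p => q ^ ((m + 1 + p.1) * (p.2 + 1)), fun _ _ => rfl⟩
  have hg := summable_geometric_of_lt_one (norm_nonneg q) hq
  have hd : Summable f := by
    refine Summable.of_norm_bounded (hg.mul_of_nonneg hg (fun _ => by positivity)
      fun _ => by positivity) fun p => ?_
    -- This exponent bound gives a product of two geometric series as majorant.
    have hle : p.1 + p.2 ≤ (m + 1 + p.1) * (p.2 + 1) := by
      nlinarith [Nat.zero_le (p.1 * p.2), Nat.zero_le (m * p.2)]
    rw [show f p = f (p.1, p.2) from rfl, hf, norm_pow, ← pow_add]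
    exact pow_le_pow_of_le_one (norm_nonneg q) hq.le hle
  have h1 : ∀ k, q ^ (m + 1 + k) / (1 - q ^ (m + 1 + k)) = ∑' s, f (k, s) := by
    intro k
    have := (hgeo (m + k) (q ^ (m + 1 + k))).tsum_eq
    rw [show m + k + 1 = m + 1 + k by ring] at this
    rw [← this]
    refine tsum_congr fun s => ?_
    rw [hf, ← pow_mul, ← pow_add]
    congr 1
    ring
  have h2 : ∀ s, q ^ ((s + 1) * (m + 1)) / (1 - q ^ (s + 1)) = ∑' k, f (k, s) := by
    intro s
    rw [← (hgeo s _).tsum_eq]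
    refine tsum_congr fun k => ?_
    rw [hf, ← pow_mul, ← pow_add]
    congr 1
    ring
  have hd' : Summable fun p : ℕ × ℕ => f p.swap := (Equiv.prodComm ℕ ℕ).summable_iff.mpr hd
  have h3 := (Equiv.prodComm ℕ ℕ).tsum_eq f
  simp only [Equiv.prodComm_apply] at h3
  rw [hd.tsum_prod, hd'.tsum_prod] at h3
  simp only [h1, h2]
  exact h3.symm

/-- At u = q the factor (q^{m+1};q)_∞ equals (q;q)_∞/(q)_m, and q^m completes the exponent m(m-1)/2
to m(m+1)/2. -/
theorem blockTerm_self {q : ℂ} (hq : ‖q‖ < 1) (m : ℕ) :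
    blockTerm q m q = qPochInf q q ^ 2 * term41 q m := by
  have h := qPoch_ne_zero hq m
  rw [blockTerm, term41, qPochInf_eq_qPoch_mul hq m, triangle_succ_eq, pow_add]
  field_simp

theorem entireBlock_self {q : ℂ} (hq : ‖q‖ < 1) :
    entireBlock q q = qPochInf q q ^ 2 * g41 q := by
  simp only [entireBlock, blockTerm_self hq, tsum_mul_left, g41]

/-- The three parts of the weight: 1 is the undifferentiated term, 2m comes from differentiating
u^m, and -4 times the Lambert sum from the squared Pochhammer symbol, one factor 2 being the square
and the other the coefficient of the derivative. -/
theorem self_mul_deriv_blockTerm {q : ℂ} (hq : ‖q‖ < 1) (m : ℕ) :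
    blockTerm q m q + 2 * (q * deriv (blockTerm q m) q) =
      qPochInf q q ^ 2 * (weight41 q m * term41 q m) := by
  have ha : ‖q * q ^ m‖ < 1 := by
    rw [norm_mul]
    exact (mul_le_of_le_one_right (norm_nonneg q) (norm_pow_le_one hq m)).trans_lt hq
  have hne := qPochInf_ne_zero_of_norm_lt_one hq ha
  have hlog := logDeriv_qPochInf hq ha
  rw [logDeriv_apply, div_eq_iff hne] at hlog
  have hsum : q * q ^ m * ∑' k : ℕ, -(q ^ k / (1 - q * q ^ m * q ^ k)) =
      -∑' s : ℕ, q ^ ((s + 1) * (m + 1)) / (1 - q ^ (s + 1)) := by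
    rw [← tsum_lambert_swap hq, ← tsum_mul_left, ← tsum_neg]
    refine tsum_congr fun k => ?_
    rw [show q ^ (m + 1 + k) = q * q ^ m * q ^ k by ring]
    ring
  have hQ : HasDerivAt (fun u => qPochInf (u * q ^ m) q)
      (deriv (fun a => qPochInf a q) (q * q ^ m) * (1 * q ^ m)) q :=
    HasDerivAt.comp q ((differentiable_qPochInf hq) _).hasDerivAt
      ((hasDerivAt_id q).mul_const (q ^ m))
  have hB : HasDerivAt (blockTerm q m)
      ((-1) ^ m * (m * q ^ (m - 1)) * q ^ (m * (m - 1) / 2) * qPochInf (q * q ^ m) q ^ 2 +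
        (-1) ^ m * q ^ m * q ^ (m * (m - 1) / 2) * (2 * qPochInf (q * q ^ m) q *
          (deriv (fun a => qPochInf a q) (q * q ^ m) * (1 * q ^ m)))) q := by
    have h := ((((hasDerivAt_pow m q).const_mul ((-1) ^ m)).mul_const
      (q ^ (m * (m - 1) / 2)))).mul (hQ.pow 2)
    exact h.congr_deriv (by simp)
  have hpow : q * (m * q ^ (m - 1)) = m * q ^ m := by
    rcases m with _ | m
    · simp
    · simp only [Nat.add_sub_cancel]; ring
  rw [mul_left_comm _ (weight41 q m), ← blockTerm_self hq, hB.deriv, hlog, weight41]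
  set S := ∑' k : ℕ, -(q ^ k / (1 - q * q ^ m * q ^ k))
  set L := ∑' s : ℕ, q ^ ((s + 1) * (m + 1)) / (1 - q ^ (s + 1))
  set Q := qPochInf (q * q ^ m) q
  rw [blockTerm]
  linear_combination 2 * (-1) ^ m * q ^ (m * (m - 1) / 2) * Q ^ 2 * hpow +
    4 * ((-1) ^ m * q ^ m * q ^ (m * (m - 1) / 2) * Q ^ 2) * hsum

theorem self_mul_deriv_entireBlock {q : ℂ} (hq : ‖q‖ < 1) :
    entireBlock q q + 2 * (q * deriv (entireBlock q) q) = qPochInf q q ^ 2 * G41 q := by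
  have h := (summable_blockTerm hq q).hasSum.add
    (((hasSum_deriv_entireBlock hq q).mul_left q).mul_left 2)
  simp only [self_mul_deriv_blockTerm hq] at h
  rw [G41, ← tsum_mul_left]
  exact h.tsum_eq.symm

/-! ### Line integrals of holomorphic functions on convex sets -/

theorem exists_primitive {f : ℂ → ℂ} {U : Set ℂ} (hU : Convex ℝ U) (hUo : IsOpen U)
    (hf : DifferentiableOn ℂ f U) : ∃ F : ℂ → ℂ, ∀ a ∈ U, HasDerivAt F (f a) a := by
  obtain ⟨F, hF⟩ := hU.exists_forall_hasDerivWithinAt hf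
  exact ⟨F, fun a ha => (hF a ha).hasDerivAt (hUo.mem_nhds ha)⟩

theorem integral_segment_eq_sub {f F : ℂ → ℂ} {U : Set ℂ} (hf : ContinuousOn f U)
    (hF : ∀ a ∈ U, HasDerivAt F (f a) a) {x z : ℂ} {R : ℝ} (hR : 0 ≤ R)
    (hmem : ∀ t : ℝ, 0 ≤ t → t ≤ R → x + t * z ∈ U) :
    ∫ t in (0 : ℝ)..R, f (x + t * z) * z = F (x + R * z) - F x := by
  have hmem' : ∀ t ∈ Set.uIcc 0 R, x + t * z ∈ U := by
    intro t ht
    rw [Set.uIcc_of_le hR] at ht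
    exact hmem t ht.1 ht.2
  have hline : ∀ t : ℝ, HasDerivAt (fun t : ℝ => x + (t : ℂ) * z) z t := by
    intro t
    simpa using ((Complex.ofRealCLM.hasDerivAt (x := t)).mul_const z).const_add x
  have := intervalIntegral.integral_eq_sub_of_hasDerivAt
    (f := fun t : ℝ => F (x + t * z)) (f' := fun t : ℝ => f (x + t * z) * z) (a := 0) (b := R)
    (fun t ht => (hF _ (hmem' t ht)).comp t (hline t)) ?_
  · simpa using this
  · refine ContinuousOn.intervalIntegrable (ContinuousOn.mul (hf.comp ?_ hmem') continuousOn_const)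
    fun_prop

theorem integrableOn_ray {f : ℂ → ℂ} {U : Set ℂ} (hf : ContinuousOn f U) {x z : ℂ}
    (hmem : ∀ t : ℝ, 0 ≤ t → x + t * z ∈ U) {C c : ℝ} (hc : 0 < c)
    (hb : ∀ t : ℝ, 0 ≤ t → ‖f (x + t * z)‖ ≤ C * Real.exp (-c * t)) :
    IntegrableOn (fun t : ℝ => f (x + t * z)) (Set.Ioi 0) := by
  refine Integrable.mono' ((exp_neg_integrableOn_Ioi 0 hc).const_mul C) ?_ ?_
  · refine ContinuousOn.aestronglyMeasurable ?_ measurableSet_Ioi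
    exact hf.comp (by fun_prop) fun t ht => hmem t (le_of_lt ht)
  · filter_upwards [ae_restrict_mem measurableSet_Ioi] with t ht
    exact hb t (le_of_lt ht)

/-- Rotation of the direction of integration across a sector in which `f` decays exponentially. -/
theorem integral_ray_eq {f : ℂ → ℂ} {U : Set ℂ} (hU : Convex ℝ U) (hUo : IsOpen U)
    (hf : DifferentiableOn ℂ f U) {x z₁ z₂ : ℂ}
    (hmem : ∀ θ : ℝ, 0 ≤ θ → θ ≤ 1 → ∀ t : ℝ, 0 ≤ t → x + t * ((1 - θ) * z₁ + θ * z₂) ∈ U)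
    {C c : ℝ} (hc : 0 < c) (hb : ∀ θ : ℝ, 0 ≤ θ → θ ≤ 1 → ∀ t : ℝ, 0 ≤ t →
      ‖f (x + t * ((1 - θ) * z₁ + θ * z₂))‖ ≤ C * Real.exp (-c * t)) :
    ∫ t in Set.Ioi (0 : ℝ), f (x + t * z₁) * z₁ = ∫ t in Set.Ioi (0 : ℝ), f (x + t * z₂) * z₂ := by
  obtain ⟨F, hF⟩ := exists_primitive hU hUo hf
  have hm₁ : ∀ t : ℝ, 0 ≤ t → x + t * z₁ ∈ U := fun t ht => by
    simpa using hmem 0 le_rfl zero_le_one t ht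
  have hm₂ : ∀ t : ℝ, 0 ≤ t → x + t * z₂ ∈ U := fun t ht => by
    simpa using hmem 1 zero_le_one le_rfl t ht
  have hi₁ := integrableOn_ray hf.continuousOn hm₁ hc
    fun t ht => by simpa using hb 0 le_rfl zero_le_one t ht
  have hi₂ := integrableOn_ray hf.continuousOn hm₂ hc
    fun t ht => by simpa using hb 1 zero_le_one le_rfl t ht
  have ht₁ := intervalIntegral_tendsto_integral_Ioi 0 (hi₁.mul_const z₁) tendsto_id
  have ht₂ := intervalIntegral_tendsto_integral_Ioi 0 (hi₂.mul_const z₂) tendsto_id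
  -- Cut off at R, the two integrals differ by the integral over the segment from x + Rz₁ to x +
  -- Rz₂, whose length is O(R) and on which f is O(e^{-cR}).
  refine sub_eq_zero.mp (tendsto_nhds_unique (ht₁.sub ht₂) ?_)
  have hlim : Tendsto (fun R : ℝ => C * ‖z₂ - z₁‖ * (R * Real.exp (-c * R))) atTop (𝓝 0) := by
    have h := tendsto_rpow_mul_exp_neg_mul_atTop_nhds_zero 1 c hc
    simpa using h.const_mul (C * ‖z₂ - z₁‖)
  refine squeeze_zero_norm' ?_ hlim
  filter_upwards [eventually_ge_atTop 0] with R hR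
  have hseg := integral_segment_eq_sub (R := 1) (x := x + R * z₁) (z := R * (z₂ - z₁))
    hf.continuousOn hF zero_le_one fun θ h0 h1 => by
      convert hmem θ h0 h1 R hR using 1; ring
  rw [id, integral_segment_eq_sub hf.continuousOn hF hR fun t ht _ => hm₁ t ht,
    integral_segment_eq_sub hf.continuousOn hF hR fun t ht _ => hm₂ t ht,
    show F (x + R * z₁) - F x - (F (x + R * z₂) - F x) =
      -(F (x + R * z₁ + (1 : ℝ) * (R * (z₂ - z₁))) - F (x + R * z₁)) by
        push_cast; ring_nf, ← hseg, norm_neg]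
  refine (intervalIntegral.norm_integral_le_of_norm_le_const
    (C := C * ‖z₂ - z₁‖ * (R * Real.exp (-c * R))) fun θ hθ => ?_).trans (by simp)
  rw [Set.uIoc_of_le zero_le_one] at hθ
  have h := hb θ hθ.1.le hθ.2 R hR
  rw [show x + R * ((1 - θ) * z₁ + θ * z₂) = x + R * z₁ + θ * (R * (z₂ - z₁)) by ring] at h
  rw [norm_mul, norm_mul, Complex.norm_real, Real.norm_of_nonneg hR]
  calc _ ≤ C * Real.exp (-c * R) * (R * ‖z₂ - z₁‖) := by gcongr
    _ = _ := by ring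

/-- Telescoping of an integral over a half-line. -/
theorem integral_Ioi_eq_of_sub_shift {k f : ℝ → ℂ} (hk : IntegrableOn k (Set.Ioi 0))
    (h : ∀ t : ℝ, 0 < t → f t = k t - k (t + 1)) :
    ∫ t in Set.Ioi (0 : ℝ), f t = ∫ t in (0 : ℝ)..1, k t := by
  have hsub : Set.Ioi (1 : ℝ) ⊆ Set.Ioi 0 := Set.Ioi_subset_Ioi zero_le_one
  have hk1 : IntegrableOn k (Set.Ioi 1) := hk.mono_set hsub
  have hpre : (fun t : ℝ => t + 1) ⁻¹' Set.Ioi 1 = Set.Ioi 0 := by ext t; simp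
  have hmp : MeasurePreserving (fun t : ℝ => t + 1) (volume.restrict (Set.Ioi 0))
      (volume.restrict (Set.Ioi 1)) := by
    have := (measurePreserving_add_right volume (1 : ℝ)).restrict_preimage
      (measurableSet_Ioi (a := (1 : ℝ)))
    rwa [hpre] at this
  have hemb : MeasurableEmbedding (fun t : ℝ => t + 1) :=
    (MeasurableEquiv.addRight (1 : ℝ)).measurableEmbedding
  have hk' : IntegrableOn (fun t => k (t + 1)) (Set.Ioi 0) :=
    (hmp.integrable_comp_emb hemb).mpr hk1
  rw [setIntegral_congr_fun measurableSet_Ioi (g := fun t => k t - k (t + 1)) fun t ht => h t ht,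
    integral_sub hk hk', hmp.integral_comp hemb k, intervalIntegral.integral_of_le zero_le_one,
    ← Set.Ioc_union_Ioi_eq_Ioi (zero_le_one (α := ℝ)),
    setIntegral_union (Set.Ioc_disjoint_Ioi le_rfl) measurableSet_Ioi
      (hk.mono_set Set.Ioc_subset_Ioi_self) hk1]
  ring

/-! ### Exponential decay of Gaussian-type integrands in a sector -/

/-- In the sector spanned by z₁ and z₂ the two exponentials do not grow, so N and 1/M are evaluated
on compact discs and stay bounded. In κ(x + tz)² the terms quadratic in t have nonpositive real
part, and the cross term 2tκxz alone supplies the exponential decay. -/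
theorem exists_sector_bound {N M : ℂ → ℂ} (hN : Continuous N) (hM : Continuous M)
    (hM0 : ∀ a, ‖a‖ < 1 → M a ≠ 0) {κ α α₀ γ γ₀ x z₁ z₂ : ℂ}
    (hα₁ : (α * z₁).re ≤ 0) (hα₂ : (α * z₂).re ≤ 0)
    (hγ₁ : (γ * z₁).re ≤ 0) (hγ₂ : (γ * z₂).re ≤ 0) (hγ : (γ * x + γ₀).re < 0)
    (hκ₁ : (κ * (x * z₁)).re < 0) (hκ₂ : (κ * (x * z₂)).re < 0)
    (hκ₁₁ : (κ * (z₁ * z₁)).re ≤ 0) (hκ₁₂ : (κ * (z₁ * z₂)).re ≤ 0)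
    (hκ₂₂ : (κ * (z₂ * z₂)).re ≤ 0) :
    ∃ C c : ℝ, 0 < c ∧ ∀ θ : ℝ, 0 ≤ θ → θ ≤ 1 → ∀ t : ℝ, 0 ≤ t →
      (γ * (x + t * ((1 - θ) * z₁ + θ * z₂)) + γ₀).re < 0 ∧
      ‖exp (κ * (x + t * ((1 - θ) * z₁ + θ * z₂)) ^ 2) *
        N (exp (α * (x + t * ((1 - θ) * z₁ + θ * z₂)) + α₀)) /
        M (exp (γ * (x + t * ((1 - θ) * z₁ + θ * z₂)) + γ₀))‖ ≤ C * Real.exp (-c * t) := by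
  have hr : Real.exp (γ * x + γ₀).re < 1 := Real.exp_lt_one_iff.mpr hγ
  obtain ⟨A, hA⟩ := (isCompact_closedBall (0 : ℂ)
    (Real.exp (α * x + α₀).re)).exists_bound_of_continuousOn hN.continuousOn
  obtain ⟨B, hB⟩ := (isCompact_closedBall (0 : ℂ)
    (Real.exp (γ * x + γ₀).re)).exists_bound_of_continuousOn (f := fun a => (M a)⁻¹)
      (hM.continuousOn.inv₀ fun a ha => hM0 a ((mem_closedBall_zero_iff.mp ha).trans_lt hr))
  set c₀ := min (-(κ * (x * z₁)).re) (-(κ * (x * z₂)).re) with hc₀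
  have hc₀pos : 0 < c₀ := lt_min (by linarith) (by linarith)
  have hc₁ : (κ * (x * z₁)).re ≤ -c₀ := by linarith [min_le_left (-(κ * (x * z₁)).re) (-(κ * (x * z₂)).re)]
  have hc₂ : (κ * (x * z₂)).re ≤ -c₀ := by linarith [min_le_right (-(κ * (x * z₁)).re) (-(κ * (x * z₂)).re)]
  refine ⟨Real.exp (κ * x ^ 2).re * A * B, 2 * c₀, by positivity, fun θ h0 h1 t ht => ?_⟩
  have hlin : ∀ δ δ₀ : ℂ, (δ * (x + t * ((1 - θ) * z₁ + θ * z₂)) + δ₀).re =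
      (δ * x + δ₀).re + t * ((1 - θ) * (δ * z₁).re + θ * (δ * z₂).re) := by
    intro δ δ₀
    rw [show δ * (x + t * ((1 - θ) * z₁ + θ * z₂)) + δ₀ = (δ * x + δ₀) +
      (((t * (1 - θ) : ℝ) : ℂ) * (δ * z₁) + ((t * θ : ℝ) : ℂ) * (δ * z₂)) by push_cast; ring]
    simp only [add_re, re_ofReal_mul]
    ring
  have hle : ∀ δ δ₀ : ℂ, (δ * z₁).re ≤ 0 → (δ * z₂).re ≤ 0 →
      (δ * (x + t * ((1 - θ) * z₁ + θ * z₂)) + δ₀).re ≤ (δ * x + δ₀).re := by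
    intro δ δ₀ hδ₁ hδ₂
    rw [hlin]
    have : (1 - θ) * (δ * z₁).re + θ * (δ * z₂).re ≤ 0 := by nlinarith
    nlinarith
  have hγle := hle γ γ₀ hγ₁ hγ₂
  refine ⟨hγle.trans_lt hγ, ?_⟩
  have hNle := hA (exp (α * (x + t * ((1 - θ) * z₁ + θ * z₂)) + α₀)) (by
    rw [mem_closedBall_zero_iff, Complex.norm_exp]
    exact Real.exp_le_exp.mpr (hle α α₀ hα₁ hα₂))
  have hMle := hB (exp (γ * (x + t * ((1 - θ) * z₁ + θ * z₂)) + γ₀)) (by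
    rw [mem_closedBall_zero_iff, Complex.norm_exp]
    exact Real.exp_le_exp.mpr hγle)
  have hexp : ‖exp (κ * (x + t * ((1 - θ) * z₁ + θ * z₂)) ^ 2)‖ ≤
      Real.exp (κ * x ^ 2).re * Real.exp (-(2 * c₀) * t) := by
    rw [Complex.norm_exp, ← Real.exp_add, Real.exp_le_exp,
      show κ * (x + t * ((1 - θ) * z₁ + θ * z₂)) ^ 2 = κ * x ^ 2 +
        (((2 * t * (1 - θ) : ℝ) : ℂ) * (κ * (x * z₁)) + ((2 * t * θ : ℝ) : ℂ) * (κ * (x * z₂)) +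
        (((t ^ 2 * (1 - θ) ^ 2 : ℝ) : ℂ) * (κ * (z₁ * z₁)) +
          ((2 * t ^ 2 * ((1 - θ) * θ) : ℝ) : ℂ) * (κ * (z₁ * z₂)) +
          ((t ^ 2 * θ ^ 2 : ℝ) : ℂ) * (κ * (z₂ * z₂)))) by push_cast; ring]
    simp only [add_re, re_ofReal_mul]
    have h1θ : 0 ≤ 1 - θ := by linarith
    have e1 := mul_le_mul_of_nonneg_left hc₁ (show 0 ≤ 2 * t * (1 - θ) by positivity)
    have e2 := mul_le_mul_of_nonneg_left hc₂ (show 0 ≤ 2 * t * θ by positivity)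
    have e3 := mul_nonpos_of_nonneg_of_nonpos
      (show 0 ≤ t ^ 2 * (1 - θ) ^ 2 by positivity) hκ₁₁
    have e4 := mul_nonpos_of_nonneg_of_nonpos
      (show 0 ≤ 2 * t ^ 2 * ((1 - θ) * θ) by positivity) hκ₁₂
    have e5 := mul_nonpos_of_nonneg_of_nonpos (show 0 ≤ t ^ 2 * θ ^ 2 by positivity) hκ₂₂
    linarith
  rw [div_eq_mul_inv, norm_mul, norm_mul]
  have hA0 : 0 ≤ A := (norm_nonneg _).trans hNle
  calc _ ≤ Real.exp (κ * x ^ 2).re * Real.exp (-(2 * c₀) * t) * A * B := by gcongr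
    _ = _ := by ring

/-! ### The exponential coordinates -/

/-- The variable `u = exp(2πb(x + c_b))`. -/
noncomputable def uVar (b x : ℂ) : ℂ := exp (2 * Real.pi * b * x + Real.pi * I * (b ^ 2 + 1))

/-- The variable `v = exp(2πb⁻¹(x - c_b))`. -/
noncomputable def vVar (b x : ℂ) : ℂ :=
  exp (2 * Real.pi * b⁻¹ * x + -(Real.pi * I * (1 + (b ^ 2)⁻¹)))

/-- The Gaussian `exp(-πix²)`. -/
noncomputable def gauss (x : ℂ) : ℂ := exp (-(Real.pi * I) * x ^ 2)

theorem differentiable_uVar (b : ℂ) : Differentiable ℂ (uVar b) := by unfold uVar; fun_prop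

theorem differentiable_vVar (b : ℂ) : Differentiable ℂ (vVar b) := by unfold vVar; fun_prop

theorem differentiable_gauss : Differentiable ℂ gauss := by unfold gauss; fun_prop

theorem uVar_ne_zero (b x : ℂ) : uVar b x ≠ 0 := exp_ne_zero _

theorem vVar_ne_zero (b x : ℂ) : vVar b x ≠ 0 := exp_ne_zero _

theorem gauss_ne_zero (x : ℂ) : gauss x ≠ 0 := exp_ne_zero _

theorem nome_ne_zero (b : ℂ) : nome b ≠ 0 := exp_ne_zero _

theorem dualNome_ne_zero (b : ℂ) : dualNome b ≠ 0 := exp_ne_zero _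

theorem exp_eq_of_sub_eq_int {x y : ℂ} (n : ℤ) (h : x = y + n * (2 * Real.pi * I)) :
    exp x = exp y := exp_eq_exp_iff_exists_int.mpr ⟨n, h⟩

theorem exp_eq_neg_of_sub_eq {x y : ℂ} (n : ℤ) (h : x = y + Real.pi * I + n * (2 * Real.pi * I)) :
    exp x = -exp y := by
  rw [exp_eq_of_sub_eq_int n h, Complex.exp_add, Complex.exp_pi_mul_I]; ring

theorem uVar_add_I_mul (b x : ℂ) : uVar b (x + I * b) = uVar b x * nome b := by
  unfold uVar nome
  rw [← Complex.exp_add]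
  congr 1
  ring

theorem uVar_add_I_mul_inv {b : ℂ} (hb : b ≠ 0) (x : ℂ) : uVar b (x + I * b⁻¹) = uVar b x := by
  refine exp_eq_of_sub_eq_int 1 ?_
  push_cast
  field_simp
  ring

theorem vVar_add_I_mul {b : ℂ} (hb : b ≠ 0) (x : ℂ) : vVar b (x + I * b) = vVar b x := by
  refine exp_eq_of_sub_eq_int 1 ?_
  push_cast
  field_simp
  ring

theorem vVar_add_I_mul_inv {b : ℂ} (hb : b ≠ 0) (x : ℂ) : vVar b (x + I * b⁻¹) * dualNome b = vVar b x := by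
  unfold vVar dualNome
  rw [← Complex.exp_add]
  congr 1
  field_simp
  ring

theorem uVar_mul_uVar_neg (b x : ℂ) : uVar b x * uVar b (-x) = nome b := by
  unfold uVar nome
  rw [← Complex.exp_add]
  refine exp_eq_of_sub_eq_int 1 ?_
  push_cast
  ring

theorem vVar_mul_vVar_neg (b x : ℂ) : vVar b x * vVar b (-x) = dualNome b := by
  unfold vVar dualNome
  rw [← Complex.exp_add]
  refine exp_eq_of_sub_eq_int (-1) ?_
  push_cast
  ring

theorem vVar_neg_add_I_mul {b : ℂ} (hb : b ≠ 0) (x : ℂ) : vVar b (-(x + I * b)) = vVar b (-x) := by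
  rw [← vVar_add_I_mul hb (-(x + I * b))]
  congr 1
  ring

theorem uVar_neg_add_I_mul_inv {b : ℂ} (hb : b ≠ 0) (x : ℂ) : uVar b (-(x + I * b⁻¹)) = uVar b (-x) := by
  rw [← uVar_add_I_mul_inv hb (-(x + I * b⁻¹))]
  congr 1
  ring

theorem uVar_neg_add_I_mul (b x : ℂ) : uVar b (-(x + I * b)) * nome b = uVar b (-x) := by
  rw [← uVar_add_I_mul b (-(x + I * b))]
  congr 1
  ring

theorem vVar_neg_add_I_mul_inv {b : ℂ} (hb : b ≠ 0) (x : ℂ) :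
    vVar b (-(x + I * b⁻¹)) = vVar b (-x) * dualNome b := by
  rw [← vVar_add_I_mul_inv hb (-(x + I * b⁻¹))]
  congr 2
  ring

/-- This quasi-periodicity makes the shift by ib match the functional equation of `entireBlock`. -/
theorem gauss_add_I_mul (b x : ℂ) : gauss (x + I * b) = -uVar b x * gauss x := by
  unfold gauss uVar
  rw [neg_mul (cexp _), ← Complex.exp_add]
  refine exp_eq_neg_of_sub_eq (-1) ?_
  push_cast
  linear_combination (-(Real.pi * I) * b ^ 2 - 2 * Real.pi * x * b) * I_sq

/-- Here `vVar b (-x)` is q̃/v, the argument of the dual block; the Gaussian stands on the shifted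
side because the right half of the integral involves its inverse. -/
theorem gauss_add_I_mul_inv (b x : ℂ) :
    gauss (x + I * b⁻¹) * (-vVar b (-x)) = gauss x := by
  unfold gauss vVar
  rw [mul_neg, ← Complex.exp_add, neg_eq_iff_eq_neg]
  refine exp_eq_neg_of_sub_eq (-1) ?_
  push_cast
  rw [← inv_pow]
  linear_combination (-(Real.pi * I) * b⁻¹ ^ 2 - 2 * Real.pi * x * b⁻¹) * I_sq

theorem two_pi_mul_cb {b : ℂ} (hb : b ≠ 0) : 2 * Real.pi * b * cb b = Real.pi * I * (b ^ 2 + 1) := by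
  unfold cb; field_simp

theorem two_pi_inv_mul_cb {b : ℂ} (hb : b ≠ 0) : 2 * Real.pi * b⁻¹ * cb b = Real.pi * I * (1 + (b ^ 2)⁻¹) := by
  unfold cb; field_simp

theorem uVar_cb {b : ℂ} (hb : b ≠ 0) : uVar b (cb b) = nome b := by
  unfold uVar nome
  rw [two_pi_mul_cb hb]
  refine exp_eq_of_sub_eq_int 1 ?_
  push_cast
  ring

theorem vVar_cb {b : ℂ} (hb : b ≠ 0) : vVar b (cb b) = 1 := by
  unfold vVar
  rw [two_pi_inv_mul_cb hb, add_neg_cancel, Complex.exp_zero]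

theorem faddeev_eq {b : ℂ} (hb : b ≠ 0) (x : ℂ) :
    faddeev b x = qPochInf (uVar b x) (nome b) / qPochInf (vVar b x) (dualNome b) := by
  unfold faddeev uVar vVar
  rw [mul_add, mul_sub, two_pi_mul_cb hb, two_pi_inv_mul_cb hb, sub_eq_add_neg]

theorem stateIntegrand_one_two {b : ℂ} (hb : b ≠ 0) (x : ℂ) : stateIntegrand 1 2 b x =
    gauss x * qPochInf (uVar b x) (nome b) ^ 2 / qPochInf (vVar b x) (dualNome b) ^ 2 := by
  rw [stateIntegrand, faddeev_eq hb, gauss]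
  simp only [Nat.cast_one, one_mul, neg_mul]
  ring

section UpperHalf

variable {b : ℂ}

theorem ne_zero_of_re_pos (hb : 0 < b.re) : b ≠ 0 := by
  rintro rfl; simp at hb

theorem im_pos_of_sq (hb : 0 < b.re) (him : 0 < (b ^ 2).im) : 0 < b.im := by
  rw [sq, mul_im] at him
  by_contra! h
  nlinarith

theorem im_inv_sq_neg (him : 0 < (b ^ 2).im) : ((b ^ 2)⁻¹).im < 0 := by
  rw [inv_im]
  refine div_neg_of_neg_of_pos (by linarith) (normSq_pos.mpr ?_)
  rintro h
  simp [h] at him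

theorem norm_nome_lt_one (him : 0 < (b ^ 2).im) : ‖nome b‖ < 1 := by
  rw [nome, Complex.norm_exp, Real.exp_lt_one_iff,
    show 2 * (Real.pi : ℂ) * I * b ^ 2 = ((2 * Real.pi : ℝ) : ℂ) * (I * b ^ 2) by push_cast; ring,
    re_ofReal_mul, I_mul_re]
  nlinarith [Real.pi_pos]

theorem norm_dualNome_lt_one (him : 0 < (b ^ 2).im) : ‖dualNome b‖ < 1 := by
  have := im_inv_sq_neg him
  rw [dualNome, Complex.norm_exp, Real.exp_lt_one_iff,
    show -(2 * (Real.pi : ℂ) * I * (b ^ 2)⁻¹) = ((-(2 * Real.pi) : ℝ) : ℂ) * (I * (b ^ 2)⁻¹) by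
      push_cast; ring, re_ofReal_mul, I_mul_re]
  nlinarith [Real.pi_pos]

/-- As b⁻¹ is a positive multiple of the conjugate of b, which has nonzero real and imaginary parts,
ib and ib⁻¹ form a real basis of ℂ. -/
theorem exists_lattice_coords (hb : 0 < b.re) (him : 0 < (b ^ 2).im) (x : ℂ) :
    ∃ s t : ℝ, x = s * (I * b) + t * (I * b⁻¹) := by
  have h1 := im_pos_of_sq hb him
  have hb0 := ne_zero_of_re_pos hb
  have hn : normSq b ≠ 0 := normSq_eq_zero.not.mpr hb0
  refine ⟨(x.im / b.re - x.re / b.im) / 2, (x.im / b.re + x.re / b.im) / 2 * normSq b, ?_⟩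
  apply Complex.ext
  · simp only [add_re, re_ofReal_mul, I_mul_re, inv_im]
    field_simp
    ring
  · simp only [add_im, im_ofReal_mul, I_mul_im, inv_re]
    field_simp
    ring

end UpperHalf

/-! ### The inversion relation, by Liouville's theorem for elliptic functions -/

theorem eq_of_doubly_periodic {f : ℂ → ℂ} (hf : Differentiable ℂ f) {p₁ p₂ : ℂ}
    (h₁ : Function.Periodic f p₁) (h₂ : Function.Periodic f p₂)
    (hcoord : ∀ x : ℂ, ∃ s t : ℝ, x = s * p₁ + t * p₂) (x y : ℂ) : f x = f y := by
  refine hf.apply_eq_apply_of_bounded ?_ x y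
  have hK : IsCompact ((fun p : ℝ × ℝ => f (p.1 * p₁ + p.2 * p₂)) ''
      (Set.Icc 0 1 ×ˢ Set.Icc 0 1)) := by
    refine (isCompact_Icc.prod isCompact_Icc).image ?_
    exact hf.continuous.comp (by fun_prop)
  refine hK.isBounded.subset ?_
  rintro _ ⟨z, rfl⟩
  obtain ⟨s, t, rfl⟩ := hcoord z
  refine ⟨(Int.fract s, Int.fract t), ⟨⟨Int.fract_nonneg s, (Int.fract_lt_one s).le⟩,
    ⟨Int.fract_nonneg t, (Int.fract_lt_one t).le⟩⟩, ?_⟩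
  have e : (s : ℂ) * p₁ + t * p₂ = (Int.fract s * p₁ + Int.fract t * p₂) + ⌊s⌋ * p₁ + ⌊t⌋ * p₂ := by
    have hs : (s : ℂ) = Int.fract s + ⌊s⌋ := by exact_mod_cast (Int.fract_add_floor s).symm
    have ht : (t : ℂ) = Int.fract t + ⌊t⌋ := by exact_mod_cast (Int.fract_add_floor t).symm
    linear_combination p₁ * hs + p₂ * ht
  simp only
  rw [e, h₂.int_mul ⌊t⌋, h₁.int_mul ⌊s⌋]

/-- Two entire functions with the same quasi-periods are proportional as soon as the zeros of one of
them form a single lattice orbit of simple zeros, which are zeros of the other. -/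
theorem exists_eq_const_mul {a d m₁ m₂ : ℂ → ℂ} (ha : Differentiable ℂ a) (hd : Differentiable ℂ d)
    {p₁ p₂ c : ℂ} (hm₁ : ∀ x, m₁ x ≠ 0) (hm₂ : ∀ x, m₂ x ≠ 0)
    (ha₁ : ∀ x, a (x + p₁) = m₁ x * a x) (hd₁ : ∀ x, d (x + p₁) = m₁ x * d x)
    (ha₂ : ∀ x, a (x + p₂) = m₂ x * a x) (hd₂ : ∀ x, d (x + p₂) = m₂ x * d x)
    (hcoord : ∀ x : ℂ, ∃ s t : ℝ, x = s * p₁ + t * p₂) (hac : a c = 0) (hdc : deriv d c ≠ 0)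
    (hd0 : ∀ x, d x = 0 ↔ ∃ j l : ℤ, x = c + j * p₁ + l * p₂) :
    ∃ K : ℂ, ∀ x, d x ≠ 0 → a x = K * d x := by
  classical
  set L := deriv a c / deriv d c with hL
  -- The quotient a/d, with every zero of d filled in by the limit L at c; by periodicity this is
  -- the correct limit at each zero.
  set W : ℂ → ℂ := fun x => if d x = 0 then L else a x / d x with hW
  have hper : ∀ p : ℂ, ∀ m : ℂ → ℂ, (∀ x, m x ≠ 0) → (∀ x, a (x + p) = m x * a x) →
      (∀ x, d (x + p) = m x * d x) → Function.Periodic W p := by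
    intro p m hm hap hdp x
    simp only [hW]
    rw [hap, hdp]
    simp only [mul_eq_zero, hm x, false_or, mul_div_mul_left _ _ (hm x)]
  have hW₁ := hper p₁ m₁ hm₁ ha₁ hd₁
  have hW₂ := hper p₂ m₂ hm₂ ha₂ hd₂
  have hdc0 : d c = 0 := (hd0 c).mpr ⟨0, 0, by simp⟩
  have hslope : ∀ f : ℂ → ℂ, Differentiable ℂ f → Differentiable ℂ (dslope f c) := by
    intro f hf
    rw [← differentiableOn_univ, Complex.differentiableOn_dslope univ_mem]
    exact hf.differentiableOn
  have hfac : ∀ f : ℂ → ℂ, f c = 0 → ∀ x, f x = (x - c) * dslope f c x := by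
    intro f hf x
    have := sub_smul_dslope f c x
    rw [hf, sub_zero, smul_eq_mul] at this
    exact this.symm
  have hdsl : dslope d c c ≠ 0 := by rwa [dslope_same]
  have hWc : DifferentiableAt ℂ W c := by
    have hratio : DifferentiableAt ℂ (fun x => dslope a c x / dslope d c x) c :=
      ((hslope a ha) c).div ((hslope d hd) c) hdsl
    refine hratio.congr_of_eventuallyEq ?_
    filter_upwards [((hslope d hd) c).continuousAt.eventually_ne hdsl] with x hx
    simp only [hW]
    by_cases hxc : x = c
    · subst hxc
      rw [if_pos hdc0, dslope_same, dslope_same]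
    · have hne : x - c ≠ 0 := sub_ne_zero.mpr hxc
      have hdx : d x ≠ 0 := by rw [hfac d hdc0]; exact mul_ne_zero hne hx
      rw [if_neg hdx, hfac a hac x, hfac d hdc0 x, mul_div_mul_left _ _ hne]
  have hWd : Differentiable ℂ W := by
    intro x
    by_cases hx : d x = 0
    · obtain ⟨j, l, rfl⟩ := (hd0 x).mp hx
      -- Differentiability at c is carried to the other zeros by the periods.
      have hshift : W = fun y => W (y - (j * p₁ + l * p₂)) := by
        ext y
        have e : W y = W ((y - (j * p₁ + l * p₂)) + j * p₁ + l * p₂) := by congr 1; ring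
        rw [e, hW₂.int_mul l, hW₁.int_mul j]
      rw [hshift]
      refine DifferentiableAt.comp (g := W) _ ?_ (by fun_prop)
      change DifferentiableAt ℂ W (c + j * p₁ + l * p₂ - (j * p₁ + l * p₂))
      rwa [add_assoc, add_sub_cancel_right]
    · refine ((ha x).div (hd x) hx).congr_of_eventuallyEq ?_
      filter_upwards [(hd x).continuousAt.eventually_ne hx] with y hy
      simp only [hW, if_neg hy, Pi.div_apply]
  refine ⟨W 0, fun x hx => ?_⟩
  rw [eq_of_doubly_periodic hWd hW₁ hW₂ hcoord 0 x]
  simp only [hW, if_neg hx]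
  field_simp

/-! ### The theta function of the denominator, its zeros and the inversion relation. -/

theorem differentiable_qPochInf_comp {q : ℂ} (hq : ‖q‖ < 1) {f : ℂ → ℂ} (hf : Differentiable ℂ f) :
    Differentiable ℂ (fun x => qPochInf (f x) q) :=
  (differentiable_qPochInf hq).comp hf

/-- The denominator theta function `(v;q̃)_∞ (q̃/v;q̃)_∞`. -/
noncomputable def dualTheta (b x : ℂ) : ℂ :=
  qPochInf (vVar b x) (dualNome b) * qPochInf (vVar b (-x)) (dualNome b)

theorem differentiable_dualTheta {b : ℂ} (him : 0 < (b ^ 2).im) :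
    Differentiable ℂ (dualTheta b) := by
  have hr := norm_dualNome_lt_one him
  exact (differentiable_qPochInf_comp hr (differentiable_vVar b)).mul
    (differentiable_qPochInf_comp hr ((differentiable_vVar b).comp differentiable_neg))

theorem dualTheta_add_I_mul {b : ℂ} (hb : b ≠ 0) (x : ℂ) :
    dualTheta b (x + I * b) = dualTheta b x := by
  rw [dualTheta, vVar_add_I_mul hb, vVar_neg_add_I_mul hb, dualTheta]

theorem dualTheta_add_I_mul_inv {b : ℂ} (hb : b ≠ 0) (him : 0 < (b ^ 2).im) (x : ℂ) :
    dualTheta b (x + I * b⁻¹) = (-vVar b (-x))⁻¹ * dualTheta b x := by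
  have hr := norm_dualNome_lt_one him
  have hw := vVar_ne_zero b (-x)
  have hr0 := dualNome_ne_zero b
  have h1 := vVar_add_I_mul_inv hb x
  have h2 := vVar_mul_vVar_neg b x
  have h3 : vVar b (x + I * b⁻¹) = (vVar b (-x))⁻¹ := by
    refine eq_inv_of_mul_eq_one_left (mul_right_cancel₀ hr0 ?_)
    linear_combination vVar b (-x) * h1 + h2
  rw [dualTheta, dualTheta, vVar_neg_add_I_mul_inv hb, qPochInf_step (vVar b (x + _)) hr, h1,
    qPochInf_step (vVar b (-x)) hr, h3]
  field_simp
  ring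

theorem deriv_vVar (b x : ℂ) : HasDerivAt (vVar b) (2 * Real.pi * b⁻¹ * vVar b x) x := by
  have := (((hasDerivAt_id x).const_mul (2 * Real.pi * b⁻¹)).add_const
    (-(Real.pi * I * (1 + (b ^ 2)⁻¹)))).cexp
  refine this.congr_deriv ?_
  rw [vVar]; simp; ring

theorem vVar_neg_cb {b : ℂ} (hb : b ≠ 0) : vVar b (-cb b) = dualNome b := by
  have := vVar_mul_vVar_neg b (cb b)
  rwa [vVar_cb hb, one_mul] at this

theorem uVar_neg_cb {b : ℂ} (hb : b ≠ 0) : uVar b (-cb b) = 1 := by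
  have := uVar_mul_uVar_neg b (cb b)
  rw [uVar_cb hb] at this
  exact mul_left_cancel₀ (nome_ne_zero b) (by rw [this, mul_one])

theorem qPochInf_one {q : ℂ} (hq : ‖q‖ < 1) : qPochInf 1 q = 0 := by
  rw [qPochInf_step 1 hq, sub_self, zero_mul]

/-- At c_b, where v = 1, only the factor 1 - v of the product vanishes, to first order; what remains
is (q̃;q̃)_∞² ≠ 0. -/
theorem deriv_dualTheta_cb_ne_zero {b : ℂ} (hb : b ≠ 0) (him : 0 < (b ^ 2).im) :
    deriv (dualTheta b) (cb b) ≠ 0 := by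
  have hr := norm_dualNome_lt_one him
  set g : ℂ → ℂ := fun x => qPochInf (vVar b x * dualNome b) (dualNome b) *
    qPochInf (vVar b (-x)) (dualNome b) with hg
  have hgd : Differentiable ℂ g :=
    (differentiable_qPochInf_comp hr ((differentiable_vVar b).mul_const _)).mul
      (differentiable_qPochInf_comp hr ((differentiable_vVar b).comp differentiable_neg))
  have hfac : dualTheta b = fun x => (1 - vVar b x) * g x := by
    ext x
    rw [dualTheta, qPochInf_step (vVar b x) hr, hg, mul_assoc]
  have hder : HasDerivAt (dualTheta b) (-(2 * Real.pi * b⁻¹ * vVar b (cb b)) * g (cb b) +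
      (1 - vVar b (cb b)) * deriv g (cb b)) (cb b) := by
    rw [hfac]
    exact ((deriv_vVar b (cb b)).const_sub 1).mul (hgd (cb b)).hasDerivAt
  rw [hder.deriv, vVar_cb hb, sub_self, zero_mul, add_zero, hg]
  simp only [vVar_cb hb, vVar_neg_cb hb, one_mul]
  have hp : (Real.pi : ℂ) ≠ 0 := ofReal_ne_zero.mpr Real.pi_ne_zero
  have hq0 := qPochInf_ne_zero_of_norm_lt_one hr hr
  simp [hp, hb, hq0]

theorem dualTheta_eq_zero_iff {b : ℂ} (hb : b ≠ 0) (him : 0 < (b ^ 2).im) (x : ℂ) :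
    dualTheta b x = 0 ↔ ∃ j l : ℤ, x = cb b + j * (I * b) + l * (I * b⁻¹) := by
  have hr := norm_dualNome_lt_one him
  have hp : (Real.pi : ℂ) ≠ 0 := ofReal_ne_zero.mpr Real.pi_ne_zero
  constructor
  · intro h
    -- A zero means that v is an integral power of q̃: a vanishing factor of (v;q̃)_∞ gives v q̃^k =
    -- 1, one of (q̃/v;q̃)_∞ gives v = q̃^{k+1}.
    obtain ⟨l, hl⟩ : ∃ l : ℤ, vVar b x * exp (l * -(2 * Real.pi * I * (b ^ 2)⁻¹)) = 1 := by
      have hpow : ∀ k : ℕ, dualNome b ^ k = exp (k * -(2 * Real.pi * I * (b ^ 2)⁻¹)) := by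
        intro k; rw [Complex.exp_nat_mul, dualNome]
      rcases mul_eq_zero.mp h with h | h
      · obtain ⟨k, hk⟩ := exists_of_qPochInf_eq_zero hr h
        exact ⟨k, by rw [← hk, hpow]; norm_cast⟩
      · obtain ⟨k, hk⟩ := exists_of_qPochInf_eq_zero hr h
        refine ⟨-(k + 1 : ℤ), ?_⟩
        have h2 := vVar_mul_vVar_neg b x
        push_cast
        rw [neg_mul, Complex.exp_neg, ← div_eq_mul_inv, div_eq_one_iff_eq (exp_ne_zero _),
          show ((k : ℂ) + 1) = ((k + 1 : ℕ) : ℂ) by push_cast; ring, ← hpow, pow_succ]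
        linear_combination -vVar b x * hk + dualNome b ^ k * h2
    unfold vVar at hl
    rw [← Complex.exp_add, Complex.exp_eq_one_iff] at hl
    obtain ⟨j, hj⟩ := hl
    refine ⟨j, l, ?_⟩
    rw [cb]
    have h2 : 2 * (Real.pi : ℂ) * b⁻¹ ≠ 0 := by simp [hp, hb]
    refine mul_left_cancel₀ h2 ?_
    field_simp at hj ⊢
    linear_combination hj
  · rintro ⟨j, l, rfl⟩
    have hK : ∀ x, dualTheta b x = 0 ↔ dualTheta b (x + I * b⁻¹) = 0 := by
      intro x
      rw [dualTheta_add_I_mul_inv hb him, mul_eq_zero]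
      simp [vVar_ne_zero]
    have h1 : ∀ l : ℤ, dualTheta b (cb b + l * (I * b⁻¹)) = 0 := by
      intro l
      induction l using Int.induction_on with
      | zero => simp [dualTheta, vVar_cb hb, qPochInf_one hr]
      | succ n ih =>
        rw [hK] at ih
        convert ih using 2
        push_cast; ring
      | pred n ih =>
        rw [hK]
        convert ih using 2
        push_cast; ring
    have hper : Function.Periodic (dualTheta b) (I * b) := dualTheta_add_I_mul hb
    rw [add_right_comm, hper.int_mul j]
    exact h1 l

/-- The inversion relation for Faddeev's quantum dilogarithm, without the value of the constant. -/
theorem exists_inversion {b : ℂ} (hbr : 0 < b.re) (him : 0 < (b ^ 2).im) :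
    ∃ K : ℂ, ∀ x, dualTheta b x ≠ 0 →
      gauss x * (qPochInf (uVar b x) (nome b) * qPochInf (uVar b (-x)) (nome b)) =
        K * dualTheta b x := by
  have hb := ne_zero_of_re_pos hbr
  have hq := norm_nome_lt_one him
  have hr := norm_dualNome_lt_one him
  refine exists_eq_const_mul (m₁ := fun _ => 1) (m₂ := fun x => (-vVar b (-x))⁻¹)
    (p₁ := I * b) (p₂ := I * b⁻¹) (c := cb b) ?_ (differentiable_dualTheta him) (by simp)
    (fun x => inv_ne_zero (neg_ne_zero.mpr (vVar_ne_zero _ _))) ?_ ?_ ?_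
    (dualTheta_add_I_mul_inv hb him) (exists_lattice_coords hbr him) ?_
    (deriv_dualTheta_cb_ne_zero hb him) (dualTheta_eq_zero_iff hb him)
  · exact differentiable_gauss.mul ((differentiable_qPochInf_comp hq (differentiable_uVar b)).mul
      (differentiable_qPochInf_comp hq ((differentiable_uVar b).comp differentiable_neg)))
  · intro x
    have hu := uVar_ne_zero b x
    have h1 := uVar_neg_add_I_mul b x
    have h2 := uVar_mul_uVar_neg b x
    have h3 : uVar b (-(x + I * b)) = (uVar b x)⁻¹ := by
      refine eq_inv_of_mul_eq_one_left (mul_right_cancel₀ (nome_ne_zero b) ?_)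
      linear_combination uVar b x * h1 + h2
    rw [qPochInf_step (uVar b (-(x + _))) hq, h1, uVar_add_I_mul, gauss_add_I_mul,
      qPochInf_step (uVar b x) hq, h3]
    field_simp
    ring
  · intro x
    rw [dualTheta_add_I_mul hb, one_mul]
  · intro x
    have h := gauss_add_I_mul_inv b x
    have hw := vVar_ne_zero b (-x)
    rw [uVar_add_I_mul_inv hb, uVar_neg_add_I_mul_inv hb, ← h]
    field_simp
  -- At c_b one has q/u = 1, so (q/u;q)_∞ vanishes there.
  · rw [uVar_neg_cb hb, qPochInf_one hq, mul_zero, mul_zero]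

/-! ### Integrals over the boundary of a parallelogram -/

/-- Subtracting from N its first-order expansion in powers of V leaves a function with a double zero
at c, so dividing by V² is harmless. Expanding in V = 1 - v rather than in x - c keeps the polar
part a function of v alone. -/
theorem exists_regular_part {U : Set ℂ} {N V : ℂ → ℂ} {c : ℂ} (hU : U ∈ 𝓝 c)
    (hN : DifferentiableOn ℂ N U) (hV : DifferentiableOn ℂ V U) (hVc : V c = 0)
    (hV' : deriv V c ≠ 0) (hV0 : ∀ x ∈ U, x ≠ c → V x ≠ 0) :
    ∃ H : ℂ → ℂ, DifferentiableOn ℂ H U ∧ ∀ x ∈ U, x ≠ c →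
      N x / V x ^ 2 = H x + (N c / V x ^ 2 + deriv N c / deriv V c / V x) := by
  set M : ℂ → ℂ := fun x => N x - N c - deriv N c / deriv V c * V x with hM
  have hNc := (hN.differentiableAt hU).hasDerivAt
  have hVcd := (hV.differentiableAt hU).hasDerivAt
  have hMd : DifferentiableOn ℂ M U := (hN.sub_const _).sub (hV.const_mul _)
  have hMc : M c = 0 := by simp [hM, hVc]
  have hM' : deriv M c = 0 := by
    have : HasDerivAt M (deriv N c - deriv N c / deriv V c * deriv V c) c :=
      (hNc.sub_const _).sub (hVcd.const_mul _)
    rw [this.deriv]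
    field_simp
    ring
  have hd := fun f : ℂ → ℂ => Complex.differentiableOn_dslope (f := f) hU
  have hfac : ∀ f : ℂ → ℂ, f c = 0 → ∀ x, f x = (x - c) * dslope f c x := by
    intro f hf x
    have := sub_smul_dslope f c x
    rw [hf, sub_zero, smul_eq_mul] at this
    exact this.symm
  have hV1 : ∀ x ∈ U, dslope V c x ≠ 0 := by
    intro x hx
    by_cases hxc : x = c
    · subst hxc; rwa [dslope_same]
    · intro h
      apply hV0 x hx hxc
      rw [hfac V hVc, h, mul_zero]
  refine ⟨fun x => dslope (dslope M c) c x / dslope V c x ^ 2, ?_, fun x hx hxc => ?_⟩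
  · exact ((hd _).mpr ((hd _).mpr hMd)).div (((hd _).mpr hV).pow 2)
      fun x hx => pow_ne_zero 2 (hV1 x hx)
  · have e1 := hfac M hMc x
    rw [hfac (dslope M c) (by rw [dslope_same, hM']) x] at e1
    have hne : x - c ≠ 0 := sub_ne_zero.mpr hxc
    have e2 : dslope (dslope M c) c x / dslope V c x ^ 2 = M x / V x ^ 2 := by
      have hV1x := hV1 x hx
      rw [e1, hfac V hVc x]
      field_simp
    have hVx := hV0 x hx hxc
    have hMx : M x = N x - N c - deriv N c / deriv V c * V x := rfl
    change _ = dslope (dslope M c) c x / dslope V c x ^ 2 + _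
    rw [e2, hMx]
    field_simp
    ring

/-- The integrand, on `[0,1]`, of the integral of `f` over the boundary of the parallelogram with
vertex `P` and sides `z₁`, `z₂`. -/
noncomputable def boundaryIntegrand (f : ℂ → ℂ) (P z₁ z₂ : ℂ) (t : ℝ) : ℂ :=
  (f (P + t * z₂) - f (P + t * z₂ + z₁)) * z₂ - (f (P + t * z₁) - f (P + t * z₁ + z₂)) * z₁

theorem mem_edges {U : Set ℂ} {P z₁ z₂ : ℂ}
    (hmem : ∀ s t : ℝ, 0 ≤ s → s ≤ 1 → 0 ≤ t → t ≤ 1 → P + s * z₁ + t * z₂ ∈ U) {t : ℝ}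
    (h0 : 0 ≤ t) (h1 : t ≤ 1) : P + t * z₂ ∈ U ∧ P + t * z₂ + z₁ ∈ U ∧ P + t * z₁ ∈ U ∧
      P + t * z₁ + z₂ ∈ U := by
  refine ⟨?_, ?_, ?_, ?_⟩
  · simpa using hmem 0 t le_rfl zero_le_one h0 h1
  · convert hmem 1 t zero_le_one le_rfl h0 h1 using 1; push_cast; ring
  · simpa using hmem t 0 h0 h1 le_rfl zero_le_one
  · simpa using hmem t 1 h0 h1 zero_le_one le_rfl

theorem continuousOn_boundaryIntegrand {f : ℂ → ℂ} {P z₁ z₂ : ℂ} {U : Set ℂ}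
    (hf : ContinuousOn f U) (hmem : ∀ t : ℝ, 0 ≤ t → t ≤ 1 → P + t * z₂ ∈ U ∧
      P + t * z₂ + z₁ ∈ U ∧ P + t * z₁ ∈ U ∧ P + t * z₁ + z₂ ∈ U) :
    ContinuousOn (boundaryIntegrand f P z₁ z₂) (Set.Icc 0 1) := by
  unfold boundaryIntegrand
  refine ContinuousOn.sub (ContinuousOn.mul (ContinuousOn.sub ?_ ?_) continuousOn_const)
    (ContinuousOn.mul (ContinuousOn.sub ?_ ?_) continuousOn_const)
  · exact hf.comp (by fun_prop) fun t ht => (hmem t ht.1 ht.2).1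
  · exact hf.comp (by fun_prop) fun t ht => (hmem t ht.1 ht.2).2.1
  · exact hf.comp (by fun_prop) fun t ht => (hmem t ht.1 ht.2).2.2.1
  · exact hf.comp (by fun_prop) fun t ht => (hmem t ht.1 ht.2).2.2.2

theorem integral_boundaryIntegrand_eq_zero {f : ℂ → ℂ} {P z₁ z₂ : ℂ} {U : Set ℂ}
    (hU : Convex ℝ U) (hUo : IsOpen U) (hf : DifferentiableOn ℂ f U)
    (hmem : ∀ t : ℝ, 0 ≤ t → t ≤ 1 → P + t * z₂ ∈ U ∧
      P + t * z₂ + z₁ ∈ U ∧ P + t * z₁ ∈ U ∧ P + t * z₁ + z₂ ∈ U) :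
    ∫ t in (0 : ℝ)..1, boundaryIntegrand f P z₁ z₂ t = 0 := by
  obtain ⟨F, hF⟩ := exists_primitive hU hUo hf
  have hc := hf.continuousOn
  have key : ∀ x z : ℂ, (∀ t : ℝ, 0 ≤ t → t ≤ 1 → x + t * z ∈ U) →
      IntervalIntegrable (fun t : ℝ => f (x + t * z) * z) volume 0 1 ∧
      ∫ t in (0 : ℝ)..1, f (x + t * z) * z = F (x + z) - F x := by
    intro x z hm
    refine ⟨ContinuousOn.intervalIntegrable (ContinuousOn.mul (hc.comp (by fun_prop) ?_)
      continuousOn_const), ?_⟩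
    · intro t ht
      rw [Set.uIcc_of_le zero_le_one] at ht
      exact hm t ht.1 ht.2
    · simpa using integral_segment_eq_sub hc hF zero_le_one hm
  have k1 := key P z₂ fun t h0 h1 => (hmem t h0 h1).1
  have k2 := key (P + z₁) z₂ fun t h0 h1 => by
    rw [add_right_comm]; exact (hmem t h0 h1).2.1
  have k3 := key P z₁ fun t h0 h1 => (hmem t h0 h1).2.2.1
  have k4 := key (P + z₂) z₁ fun t h0 h1 => by
    rw [add_right_comm]; exact (hmem t h0 h1).2.2.2
  have e : ∀ t : ℝ, boundaryIntegrand f P z₁ z₂ t =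
      (f (P + t * z₂) * z₂ - f (P + z₁ + t * z₂) * z₂) -
        (f (P + t * z₁) * z₁ - f (P + z₂ + t * z₁) * z₁) := by
    intro t
    rw [boundaryIntegrand, add_right_comm P z₁, add_right_comm P z₂]
    ring
  simp only [e]
  rw [intervalIntegral.integral_sub (k1.1.sub k2.1) (k3.1.sub k4.1),
    intervalIntegral.integral_sub k1.1 k2.1, intervalIntegral.integral_sub k3.1 k4.1,
    k1.2, k2.2, k3.2, k4.2, add_right_comm P z₁]
  ring

/-! ### Integrals of `A / (1 - v)² + B / (1 - v)` over circles -/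

theorem hasDerivAt_mul_exp (z : ℂ) (t : ℝ) :
    HasDerivAt (fun t : ℝ => z * exp (2 * Real.pi * I * t))
      (2 * Real.pi * I * (z * exp (2 * Real.pi * I * t))) t := by
  have h := (((Complex.ofRealCLM.hasDerivAt (x := t)).const_mul
    (2 * (Real.pi : ℂ) * I)).cexp).const_mul z
  refine h.congr_deriv ?_
  simp
  ring

theorem norm_mul_exp_two_pi (z : ℂ) (t : ℝ) : ‖z * exp (2 * Real.pi * I * t)‖ = ‖z‖ := by
  rw [show 2 * (Real.pi : ℂ) * I * t = ((2 * Real.pi * t : ℝ) : ℂ) * I by push_cast; ring,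
    norm_mul, Complex.norm_exp_ofReal_mul_I, mul_one]

theorem one_sub_mem_slitPlane {w : ℂ} (h : ‖w‖ < 1) : 1 - w ∈ slitPlane := by
  left
  have := (abs_le.mp (Complex.abs_re_le_norm w)).2
  simp only [sub_re, one_re]
  linarith

theorem two_pi_I_ne : 2 * (Real.pi : ℂ) * I ≠ 0 := Complex.two_pi_I_ne_zero

/-- With w = z e^{2πit} an explicit primitive is (A + B)t plus functions of w that are periodic in
t. The principal logarithm of 1 - w is legitimate because 1 - w stays in the right half-plane. -/
theorem integral_circle_of_norm_lt_one (A B : ℂ) {z : ℂ} (hz : ‖z‖ < 1) :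
    ∫ t in (0 : ℝ)..1, (A / (1 - z * exp (2 * Real.pi * I * t)) ^ 2 +
      B / (1 - z * exp (2 * Real.pi * I * t))) = A + B := by
  have hw : ∀ t : ℝ, ‖z * exp (2 * Real.pi * I * t)‖ < 1 := fun t => by
    rwa [norm_mul_exp_two_pi]
  have hne : ∀ t : ℝ, 1 - z * exp (2 * Real.pi * I * t) ≠ 0 := fun t =>
    slitPlane_ne_zero (one_sub_mem_slitPlane (hw t))
  have hpi := two_pi_I_ne
  have hder : ∀ t : ℝ, HasDerivAt (fun t : ℝ => (A + B) * t +
      (A / (2 * Real.pi * I) * (1 - z * exp (2 * Real.pi * I * t))⁻¹ -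
        (A + B) / (2 * Real.pi * I) * log (1 - z * exp (2 * Real.pi * I * t))))
      (A / (1 - z * exp (2 * Real.pi * I * t)) ^ 2 +
        B / (1 - z * exp (2 * Real.pi * I * t))) t := by
    intro t
    have h1 := (hasDerivAt_mul_exp z t).const_sub 1
    have h2 := (Complex.ofRealCLM.hasDerivAt (x := t)).const_mul (A + B)
    have h3 := h2.add (((h1.inv (hne t)).const_mul (A / (2 * Real.pi * I))).sub
      ((h1.clog_real (one_sub_mem_slitPlane (hw t))).const_mul ((A + B) / (2 * Real.pi * I))))
    refine h3.congr_deriv ?_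
    have := hne t
    simp only [ofRealCLM_apply, ofReal_one, mul_one]
    generalize z * exp (2 * Real.pi * I * t) = w at this ⊢
    generalize 2 * (Real.pi : ℂ) * I = p at hpi ⊢
    field_simp
    ring
  rw [intervalIntegral.integral_eq_sub_of_hasDerivAt (fun t _ => hder t)]
  · simp [Complex.exp_two_pi_mul_I]
  · refine Continuous.intervalIntegrable ?_ 0 1
    have hc : Continuous fun t : ℝ => 1 - z * exp (2 * Real.pi * I * t) := by fun_prop
    exact (continuous_const.div (hc.pow 2) fun t => pow_ne_zero 2 (hne t)).add
      (continuous_const.div hc hne)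

/-- Outside the unit circle log(1 - w⁻¹) replaces log(1 - w). It absorbs the linear term, so the
primitive is periodic. -/
theorem integral_circle_of_one_lt_norm (A B : ℂ) {z : ℂ} (hz : 1 < ‖z‖) :
    ∫ t in (0 : ℝ)..1, (A / (1 - z * exp (2 * Real.pi * I * t)) ^ 2 +
      B / (1 - z * exp (2 * Real.pi * I * t))) = 0 := by
  have hw0 : ∀ t : ℝ, z * exp (2 * Real.pi * I * t) ≠ 0 := fun t => by
    rw [← norm_ne_zero_iff, norm_mul_exp_two_pi]; linarith
  have hw : ∀ t : ℝ, ‖(z * exp (2 * Real.pi * I * t))⁻¹‖ < 1 := fun t => by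
    rw [norm_inv, norm_mul_exp_two_pi]; exact inv_lt_one_of_one_lt₀ hz
  have hne' : ∀ t : ℝ, 1 - (z * exp (2 * Real.pi * I * t))⁻¹ ≠ 0 := fun t =>
    slitPlane_ne_zero (one_sub_mem_slitPlane (hw t))
  have hne : ∀ t : ℝ, 1 - z * exp (2 * Real.pi * I * t) ≠ 0 := by
    intro t h
    have h1 := norm_mul_exp_two_pi z t
    rw [← sub_eq_zero.mp h, norm_one] at h1
    linarith
  have hpi := two_pi_I_ne
  have hder : ∀ t : ℝ, HasDerivAt (fun t : ℝ =>
      (A / (2 * Real.pi * I) * (1 - z * exp (2 * Real.pi * I * t))⁻¹ -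
        (A + B) / (2 * Real.pi * I) * log (1 - (z * exp (2 * Real.pi * I * t))⁻¹)))
      (A / (1 - z * exp (2 * Real.pi * I * t)) ^ 2 +
        B / (1 - z * exp (2 * Real.pi * I * t))) t := by
    intro t
    have h0 := hasDerivAt_mul_exp z t
    have h1 := h0.const_sub 1
    have h2 := (h0.inv (hw0 t)).const_sub 1
    have h3 := (((h1.inv (hne t)).const_mul (A / (2 * Real.pi * I))).sub
      ((h2.clog_real (one_sub_mem_slitPlane (hw t))).const_mul ((A + B) / (2 * Real.pi * I))))
    refine h3.congr_deriv ?_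
    have n1 := hne t
    have n2 := hw0 t
    have n3 := hne' t
    simp only [Pi.inv_apply]
    generalize z * exp (2 * Real.pi * I * t) = w at n1 n2 n3 ⊢
    generalize 2 * (Real.pi : ℂ) * I = p at hpi ⊢
    have n4 : w - 1 ≠ 0 := by rw [← neg_ne_zero]; simpa using n1
    have e1 : 1 - w⁻¹ = (w - 1) / w := by field_simp
    have e2 : 1 - w = -(w - 1) := by ring
    rw [e1, e2]
    field_simp
    ring
  rw [intervalIntegral.integral_eq_sub_of_hasDerivAt (fun t _ => hder t)]
  · simp [Complex.exp_two_pi_mul_I]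
  · refine Continuous.intervalIntegrable ?_ 0 1
    have hc : Continuous fun t : ℝ => 1 - z * exp (2 * Real.pi * I * t) := by fun_prop
    exact (continuous_const.div (hc.pow 2) fun t => pow_ne_zero 2 (hne t)).add
      (continuous_const.div hc hne)

theorem convex_norm_exp_lt (γ γ₀ : ℂ) : Convex ℝ {x : ℂ | ‖exp (γ * x + γ₀)‖ < 1} := by
  have : {x : ℂ | ‖exp (γ * x + γ₀)‖ < 1} =
      (fun x => (reCLM ∘L (ContinuousLinearMap.mul ℝ ℂ γ)) x) ⁻¹' Set.Iio (-γ₀.re) := by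
    ext x
    simp only [Set.mem_ofPred_eq, Complex.norm_exp, Real.exp_lt_one_iff, add_re, Set.mem_preimage,
      ContinuousLinearMap.coe_comp, Function.comp_apply, ContinuousLinearMap.mul_apply',
      reCLM_apply, Set.mem_Iio]
    constructor <;> intro h <;> linarith
  rw [this]
  exact (convex_Iio _).linear_preimage
    (reCLM ∘L (ContinuousLinearMap.mul ℝ ℂ γ)).toLinearMap

theorem isOpen_norm_lt_one {f : ℂ → ℂ} (hf : Continuous f) : IsOpen {x : ℂ | ‖f x‖ < 1} :=
  isOpen_lt hf.norm continuous_const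

/-! ### The state integral as an integral over the boundary of a period parallelogram -/

/-- In lattice coordinates |u| depends only on s and |v| only on t; every question about the
position of a point relative to the poles thus becomes an inequality between real numbers. -/
theorem uVar_coords {b : ℂ} (hb : b ≠ 0) (s t : ℝ) :
    ‖uVar b (s * (I * b) + t * (I * b⁻¹))‖ =
      Real.exp (-(2 * Real.pi * (b ^ 2).im) * (s + 1 / 2)) := by
  rw [uVar, Complex.norm_exp, show 2 * (Real.pi : ℂ) * b * (s * (I * b) + t * (I * b⁻¹)) +
    Real.pi * I * (b ^ 2 + 1) = ((2 * Real.pi * (s + 1 / 2) : ℝ) : ℂ) * (I * b ^ 2) +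
      ((2 * Real.pi * t + Real.pi : ℝ) : ℂ) * I by push_cast; field_simp; ring,
    add_re, re_ofReal_mul, re_ofReal_mul, I_mul_re, I_re]
  ring_nf

theorem vVar_coords {b : ℂ} (hb : b ≠ 0) (s t : ℝ) :
    ‖vVar b (s * (I * b) + t * (I * b⁻¹))‖ =
      Real.exp (2 * Real.pi * ((b ^ 2)⁻¹).im * (1 / 2 - t)) := by
  rw [vVar, Complex.norm_exp, show 2 * (Real.pi : ℂ) * b⁻¹ * (s * (I * b) + t * (I * b⁻¹)) +
    -(Real.pi * I * (1 + (b ^ 2)⁻¹)) = ((2 * Real.pi * (t - 1 / 2) : ℝ) : ℂ) * (I * (b ^ 2)⁻¹) +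
      ((2 * Real.pi * s - Real.pi : ℝ) : ℂ) * I by push_cast; field_simp; ring,
    add_re, re_ofReal_mul, re_ofReal_mul, I_mul_re, I_re]
  ring_nf

theorem uVar_neg_coords {b : ℂ} (hb : b ≠ 0) (s t : ℝ) :
    ‖uVar b (-(s * (I * b) + t * (I * b⁻¹)))‖ =
      Real.exp (-(2 * Real.pi * (b ^ 2).im) * (1 / 2 - s)) := by
  have := uVar_coords hb (-s) (-t)
  push_cast at this
  rw [show -((s : ℂ) * (I * b) + t * (I * b⁻¹)) = -s * (I * b) + -t * (I * b⁻¹) by ring, this]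
  ring_nf

theorem vVar_neg_coords {b : ℂ} (hb : b ≠ 0) (s t : ℝ) :
    ‖vVar b (-(s * (I * b) + t * (I * b⁻¹)))‖ =
      Real.exp (2 * Real.pi * ((b ^ 2)⁻¹).im * (1 / 2 + t)) := by
  have := vVar_coords hb (-s) (-t)
  push_cast at this
  rw [show -((s : ℂ) * (I * b) + t * (I * b⁻¹)) = -s * (I * b) + -t * (I * b⁻¹) by ring, this]
  ring_nf

theorem norm_nome (b : ℂ) : ‖nome b‖ = Real.exp (-(2 * Real.pi * (b ^ 2).im)) := by
  rw [nome, Complex.norm_exp,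
    show 2 * (Real.pi : ℂ) * I * b ^ 2 = ((2 * Real.pi : ℝ) : ℂ) * (I * b ^ 2) by push_cast; ring,
    re_ofReal_mul, I_mul_re]
  ring_nf

theorem norm_dualNome (b : ℂ) : ‖dualNome b‖ = Real.exp (2 * Real.pi * ((b ^ 2)⁻¹).im) := by
  rw [dualNome, Complex.norm_exp,
    show -(2 * (Real.pi : ℂ) * I * (b ^ 2)⁻¹) = ((-(2 * Real.pi) : ℝ) : ℂ) * (I * (b ^ 2)⁻¹) by
      push_cast; ring, re_ofReal_mul, I_mul_re]
  ring_nf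

theorem mul_cb_eq (b : ℂ) (r : ℝ) :
    (r : ℂ) * cb b = ((r / 2 : ℝ) : ℂ) * (I * b) + ((r / 2 : ℝ) : ℂ) * (I * b⁻¹) := by
  rw [cb]; push_cast; ring

/-- A Gaussian times a quotient of functions of exponentials. -/
noncomputable def gaussQuot (N M : ℂ → ℂ) (κ α α₀ γ γ₀ x : ℂ) : ℂ :=
  exp (κ * x ^ 2) * N (exp (α * x + α₀)) / M (exp (γ * x + γ₀))

theorem differentiableOn_gaussQuot {N M : ℂ → ℂ} (hN : Differentiable ℂ N)
    (hM : Differentiable ℂ M) (hM0 : ∀ a, ‖a‖ < 1 → M a ≠ 0) (κ α α₀ γ γ₀ : ℂ) :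
    DifferentiableOn ℂ (gaussQuot N M κ α α₀ γ γ₀) {x | ‖exp (γ * x + γ₀)‖ < 1} := by
  have h1 : Differentiable ℂ fun x => N (exp (α * x + α₀)) := hN.comp (by fun_prop)
  have h2 : Differentiable ℂ fun x => M (exp (γ * x + γ₀)) := hM.comp (by fun_prop)
  have h3 : Differentiable ℂ fun x : ℂ => exp (κ * x ^ 2) := by fun_prop
  exact (h3.mul h1).differentiableOn.div h2.differentiableOn fun x hx => hM0 _ hx

/-- A half-line integral of `f`, rotated to a direction `z₂` along which `f` telescopes as
`k(x) - k(x + z₂)`. -/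
theorem integral_ray_gaussQuot {N N' M : ℂ → ℂ} (hN : Differentiable ℂ N)
    (hN' : Differentiable ℂ N') (hM : Differentiable ℂ M) (hM0 : ∀ a, ‖a‖ < 1 → M a ≠ 0)
    {κ α α₀ γ γ₀ x z₁ z₂ : ℂ}
    (hα₁ : (α * z₁).re ≤ 0) (hα₂ : (α * z₂).re ≤ 0)
    (hγ₁ : (γ * z₁).re ≤ 0) (hγ₂ : (γ * z₂).re ≤ 0) (hγ : ‖exp (γ * x + γ₀)‖ < 1)
    (hκ₁ : (κ * (x * z₁)).re < 0) (hκ₂ : (κ * (x * z₂)).re < 0)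
    (hκ₁₁ : (κ * (z₁ * z₁)).re ≤ 0) (hκ₁₂ : (κ * (z₁ * z₂)).re ≤ 0)
    (hκ₂₂ : (κ * (z₂ * z₂)).re ≤ 0)
    (htel : ∀ y, gaussQuot N M κ α α₀ γ γ₀ y =
      gaussQuot N' M κ α α₀ γ γ₀ y - gaussQuot N' M κ α α₀ γ γ₀ (y + z₂)) :
    IntegrableOn (fun t : ℝ => gaussQuot N M κ α α₀ γ γ₀ (x + t * z₁)) (Set.Ioi 0) ∧
    ∫ t in Set.Ioi (0 : ℝ), gaussQuot N M κ α α₀ γ γ₀ (x + t * z₁) * z₁ =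
      ∫ t in (0 : ℝ)..1, gaussQuot N' M κ α α₀ γ γ₀ (x + t * z₂) * z₂ := by
  rw [Complex.norm_exp, Real.exp_lt_one_iff] at hγ
  obtain ⟨C, c, hc, hbd⟩ := exists_sector_bound hN.continuous hM.continuous hM0 hα₁ hα₂ hγ₁ hγ₂
    (α₀ := α₀) hγ hκ₁ hκ₂ hκ₁₁ hκ₁₂ hκ₂₂
  obtain ⟨C', c', hc', hbd'⟩ := exists_sector_bound hN'.continuous hM.continuous hM0 hα₁ hα₂ hγ₁
    hγ₂ (α₀ := α₀) hγ hκ₁ hκ₂ hκ₁₁ hκ₁₂ hκ₂₂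
  have hUo : IsOpen {x : ℂ | ‖exp (γ * x + γ₀)‖ < 1} := isOpen_norm_lt_one (by fun_prop)
  have hd := differentiableOn_gaussQuot hN hM hM0 κ α α₀ γ γ₀
  have hd' := differentiableOn_gaussQuot hN' hM hM0 κ α α₀ γ γ₀
  have hmem : ∀ θ : ℝ, 0 ≤ θ → θ ≤ 1 → ∀ t : ℝ, 0 ≤ t →
      x + t * ((1 - θ) * z₁ + θ * z₂) ∈ {x : ℂ | ‖exp (γ * x + γ₀)‖ < 1} := by
    intro θ h0 h1 t ht
    rw [Set.mem_ofPred_eq, Complex.norm_exp, Real.exp_lt_one_iff]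
    exact (hbd θ h0 h1 t ht).1
  refine ⟨integrableOn_ray hd.continuousOn (fun t ht => ?_) hc (C := C) fun t ht => ?_, ?_⟩
  · simpa using hmem 0 le_rfl zero_le_one t ht
  · simpa [gaussQuot] using (hbd 0 le_rfl zero_le_one t ht).2
  rw [integral_ray_eq (convex_norm_exp_lt γ γ₀) hUo hd hmem hc
    fun θ h0 h1 t ht => (hbd θ h0 h1 t ht).2]
  refine integral_Ioi_eq_of_sub_shift (Integrable.mul_const ?_ z₂) fun t _ => ?_
  · refine integrableOn_ray hd'.continuousOn (fun t ht => ?_) hc' (C := C') fun t ht => ?_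
    · simpa using hmem 1 zero_le_one le_rfl t ht
    · simpa [gaussQuot] using (hbd' 1 zero_le_one le_rfl t ht).2
  · rw [htel, show x + ((t + 1 : ℝ) : ℂ) * z₂ = x + t * z₂ + z₂ by push_cast; ring]
    ring

/-- The function whose boundary integral over a period parallelogram is the state integral. -/
noncomputable def blockIntegrand (b x : ℂ) : ℂ :=
  gauss x * entireBlock (nome b) (uVar b x) * entireBlock (dualNome b) (vVar b (-x)) /
    dualTheta b x ^ 2

/-- Under x ↦ x + ib only the Gaussian and the block in u change, and `entireBlock_step` collapses
their difference. The identity survives at zeros of θ, where both quotients are 0 by convention. -/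
theorem blockIntegrand_sub_add_I_mul {b : ℂ} (hb : b ≠ 0) (him : 0 < (b ^ 2).im) (x : ℂ) :
    blockIntegrand b x - blockIntegrand b (x + I * b) =
      gauss x * qPochInf (uVar b x) (nome b) ^ 2 * entireBlock (dualNome b) (vVar b (-x)) /
        dualTheta b x ^ 2 := by
  rw [blockIntegrand, blockIntegrand, dualTheta_add_I_mul hb, vVar_neg_add_I_mul hb,
    gauss_add_I_mul, uVar_add_I_mul, ← entireBlock_step (norm_nome_lt_one him)]
  ring

theorem blockIntegrand_sub_add_I_mul_inv {b : ℂ} (hb : b ≠ 0) (him : 0 < (b ^ 2).im) (x : ℂ) :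
    blockIntegrand b x - blockIntegrand b (x + I * b⁻¹) =
      gauss x * entireBlock (nome b) (uVar b x) * qPochInf (vVar b (-x)) (dualNome b) ^ 2 /
        dualTheta b x ^ 2 := by
  have hw := vVar_ne_zero b (-x)
  rw [blockIntegrand, blockIntegrand, dualTheta_add_I_mul_inv hb him, vVar_neg_add_I_mul_inv hb,
    ← gauss_add_I_mul_inv b x, uVar_add_I_mul_inv hb, ← entireBlock_step (norm_dualNome_lt_one him)]
  field_simp
  ring

theorem differentiable_qPochInf_sq {q : ℂ} (hq : ‖q‖ < 1) :
    Differentiable ℂ fun a => qPochInf a q ^ 2 := (differentiable_qPochInf hq).pow 2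

/-- The left half of the state integral. -/
theorem integral_left {b : ℂ} (hbr : 0 < b.re) (him : 0 < (b ^ 2).im) {r : ℝ} (hr0 : 0 < r)
    (hr1 : r < 1) (hcb : 0 < (cb b).im) :
    IntegrableOn (fun t : ℝ => stateIntegrand 1 2 b (r * cb b + t * (-1))) (Set.Ioi 0) ∧
    ∫ t in Set.Ioi (0 : ℝ), stateIntegrand 1 2 b (r * cb b + t * (-1)) * (-1) =
      ∫ t in (0 : ℝ)..1, gauss (r * cb b + t * (I * b)) *
        entireBlock (nome b) (uVar b (r * cb b + t * (I * b))) /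
          qPochInf (vVar b (r * cb b + t * (I * b))) (dualNome b) ^ 2 * (I * b) := by
  have hb := ne_zero_of_re_pos hbr
  have hq := norm_nome_lt_one him
  have hq' := norm_dualNome_lt_one him
  have hinv := im_inv_sq_neg him
  have hpi := Real.pi_pos
  have hfun : stateIntegrand 1 2 b = gaussQuot (fun a => qPochInf a (nome b) ^ 2)
      (fun a => qPochInf a (dualNome b) ^ 2) (-(Real.pi * I)) (2 * Real.pi * b)
      (Real.pi * I * (b ^ 2 + 1)) (2 * Real.pi * b⁻¹) (-(Real.pi * I * (1 + (b ^ 2)⁻¹))) :=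
    funext fun x => stateIntegrand_one_two hb x
  rw [hfun]
  have hbinv : 0 < (b⁻¹).re := by
    rw [inv_re]; exact div_pos hbr (normSq_pos.mpr hb)
  refine integral_ray_gaussQuot (N' := entireBlock (nome b)) (differentiable_qPochInf_sq hq)
    (differentiable_entireBlock hq) (differentiable_qPochInf_sq hq')
    (fun a ha => pow_ne_zero 2 (qPochInf_ne_zero_of_norm_lt_one hq' ha)) ?_ ?_ ?_ ?_ ?_ ?_ ?_ ?_ ?_
    ?_ ?_
  · rw [show 2 * (Real.pi : ℂ) * b * -1 = ((-(2 * Real.pi) : ℝ) : ℂ) * b by push_cast; ring,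
      re_ofReal_mul]
    nlinarith
  · rw [show 2 * (Real.pi : ℂ) * b * (I * b) = ((2 * Real.pi : ℝ) : ℂ) * (I * b ^ 2) by
      push_cast; ring, re_ofReal_mul, I_mul_re]
    nlinarith
  · rw [show 2 * (Real.pi : ℂ) * b⁻¹ * -1 = ((-(2 * Real.pi) : ℝ) : ℂ) * b⁻¹ by push_cast; ring,
      re_ofReal_mul]
    nlinarith
  -- The direction ib only rotates v, so the bound |v| < 1 at the base point persists along the ray.
  · rw [show 2 * (Real.pi : ℂ) * b⁻¹ * (I * b) = ((2 * Real.pi : ℝ) : ℂ) * I by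
      push_cast; field_simp, re_ofReal_mul, I_re, mul_zero]
  · change ‖vVar b (r * cb b)‖ < 1
    rw [mul_cb_eq, vVar_coords hb, Real.exp_lt_one_iff]
    have : 0 < 1 / 2 - r / 2 := by linarith
    have := mul_pos hpi this
    nlinarith
  · rw [show -((Real.pi : ℂ) * I) * (r * cb b * -1) = ((Real.pi * r : ℝ) : ℂ) * (I * cb b) by
      push_cast; ring, re_ofReal_mul, I_mul_re]
    nlinarith [mul_pos (mul_pos hpi hr0) hcb]
  · rw [show -((Real.pi : ℂ) * I) * (r * cb b * (I * b)) =
      ((Real.pi * r / 2 : ℝ) : ℂ) * (I * (b ^ 2 + 1)) by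
        rw [cb]; push_cast; field_simp; ring_nf; simp only [I_sq]; ring,
        re_ofReal_mul, I_mul_re, add_im, one_im]
    have := mul_pos (mul_pos hpi hr0) him
    nlinarith
  · simp
  · rw [show -((Real.pi : ℂ) * I) * (-1 * (I * b)) = ((-Real.pi : ℝ) : ℂ) * b by
      push_cast; linear_combination Real.pi * b * I_sq, re_ofReal_mul]
    nlinarith
  · rw [show -((Real.pi : ℂ) * I) * (I * b * (I * b)) = ((Real.pi : ℝ) : ℂ) * (I * b ^ 2) by
      linear_combination -Real.pi * b ^ 2 * I * I_sq, re_ofReal_mul, I_mul_re]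
    nlinarith
  · intro y
    change gauss y * qPochInf (uVar b y) (nome b) ^ 2 / qPochInf (vVar b y) (dualNome b) ^ 2 =
      gauss y * entireBlock (nome b) (uVar b y) / qPochInf (vVar b y) (dualNome b) ^ 2 -
      gauss (y + I * b) * entireBlock (nome b) (uVar b (y + I * b)) /
        qPochInf (vVar b (y + I * b)) (dualNome b) ^ 2
    rw [gauss_add_I_mul, uVar_add_I_mul, vVar_add_I_mul hb, ← entireBlock_step hq]
    ring

/-- The right half of the state integral, in the form given by the inversion relation. -/
theorem integral_right {b : ℂ} (hbr : 0 < b.re) (him : 0 < (b ^ 2).im) {r : ℝ} (hr0 : 0 < r)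
    (hr1 : r < 1) (hcb : 0 < (cb b).im) :
    IntegrableOn (fun t : ℝ => (gauss (r * cb b + t * 1))⁻¹ *
      qPochInf (vVar b (-(r * cb b + t * 1))) (dualNome b) ^ 2 /
        qPochInf (uVar b (-(r * cb b + t * 1))) (nome b) ^ 2) (Set.Ioi 0) ∧
    ∫ t in Set.Ioi (0 : ℝ), (gauss (r * cb b + t * 1))⁻¹ *
      qPochInf (vVar b (-(r * cb b + t * 1))) (dualNome b) ^ 2 /
        qPochInf (uVar b (-(r * cb b + t * 1))) (nome b) ^ 2 * 1 =
      ∫ t in (0 : ℝ)..1, (gauss (r * cb b + t * (I * b⁻¹)))⁻¹ *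
        entireBlock (dualNome b) (vVar b (-(r * cb b + t * (I * b⁻¹)))) /
          qPochInf (uVar b (-(r * cb b + t * (I * b⁻¹)))) (nome b) ^ 2 * (I * b⁻¹) := by
  have hb := ne_zero_of_re_pos hbr
  have hq := norm_nome_lt_one him
  have hq' := norm_dualNome_lt_one him
  have hinv := im_inv_sq_neg him
  have hpi := Real.pi_pos
  have hfun : ∀ N : ℂ → ℂ, ∀ x : ℂ, (gauss x)⁻¹ * N (vVar b (-x)) /
      qPochInf (uVar b (-x)) (nome b) ^ 2 = gaussQuot N
      (fun a => qPochInf a (nome b) ^ 2) (Real.pi * I) (-(2 * Real.pi * b⁻¹))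
      (-(Real.pi * I * (1 + (b ^ 2)⁻¹))) (-(2 * Real.pi * b)) (Real.pi * I * (b ^ 2 + 1)) x := by
    intro N x
    rw [gauss, ← Complex.exp_neg, gaussQuot, vVar, uVar]
    simp only [neg_mul, neg_neg, mul_neg]
  simp only [hfun (fun a => qPochInf a (dualNome b) ^ 2), hfun (entireBlock (dualNome b))]
  have hbinv : 0 < (b⁻¹).re := by
    rw [inv_re]; exact div_pos hbr (normSq_pos.mpr hb)
  refine integral_ray_gaussQuot (N' := entireBlock (dualNome b)) (differentiable_qPochInf_sq hq')
    (differentiable_entireBlock hq') (differentiable_qPochInf_sq hq)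
    (fun a ha => pow_ne_zero 2 (qPochInf_ne_zero_of_norm_lt_one hq ha)) ?_ ?_ ?_ ?_ ?_ ?_ ?_ ?_ ?_
    ?_ ?_
  · rw [show -(2 * (Real.pi : ℂ) * b⁻¹) * 1 = ((-(2 * Real.pi) : ℝ) : ℂ) * b⁻¹ by push_cast; ring,
      re_ofReal_mul]
    nlinarith
  · rw [show -(2 * (Real.pi : ℂ) * b⁻¹) * (I * b⁻¹) =
      ((-(2 * Real.pi) : ℝ) : ℂ) * (I * (b ^ 2)⁻¹) by
      push_cast; field_simp, re_ofReal_mul, I_mul_re]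
    nlinarith
  · rw [show -(2 * (Real.pi : ℂ) * b) * 1 = ((-(2 * Real.pi) : ℝ) : ℂ) * b by push_cast; ring,
      re_ofReal_mul]
    nlinarith
  · rw [show -(2 * (Real.pi : ℂ) * b) * (I * b⁻¹) = ((-(2 * Real.pi) : ℝ) : ℂ) * I by
      push_cast; field_simp, re_ofReal_mul, I_re, mul_zero]
  · rw [show -(2 * (Real.pi : ℂ) * b) * (r * cb b) = 2 * Real.pi * b * -(r * cb b) by ring]
    change ‖uVar b (-(r * cb b))‖ < 1
    rw [mul_cb_eq, uVar_neg_coords hb, Real.exp_lt_one_iff]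
    have : 0 < 1 / 2 - r / 2 := by linarith
    have := mul_pos hpi this
    nlinarith
  · rw [show (Real.pi : ℂ) * I * (r * cb b * 1) = ((Real.pi * r : ℝ) : ℂ) * (I * cb b) by
      push_cast; ring, re_ofReal_mul, I_mul_re]
    nlinarith [mul_pos (mul_pos hpi hr0) hcb]
  · rw [show (Real.pi : ℂ) * I * (r * cb b * (I * b⁻¹)) =
      ((-(Real.pi * r / 2) : ℝ) : ℂ) * (I * (1 + (b ^ 2)⁻¹)) by
        rw [cb]; push_cast; field_simp; ring_nf; simp only [I_sq]; ring,
        re_ofReal_mul, I_mul_re, add_im, one_im]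
    have := mul_pos (mul_pos hpi hr0) (neg_pos.mpr hinv)
    nlinarith
  · simp
  · rw [show (Real.pi : ℂ) * I * (1 * (I * b⁻¹)) = ((-Real.pi : ℝ) : ℂ) * b⁻¹ by
      push_cast; linear_combination Real.pi * b⁻¹ * I_sq, re_ofReal_mul]
    nlinarith
  · rw [show (Real.pi : ℂ) * I * (I * b⁻¹ * (I * b⁻¹)) =
      ((-Real.pi : ℝ) : ℂ) * (I * (b ^ 2)⁻¹) by
      rw [← inv_pow]; push_cast
      linear_combination Real.pi * b⁻¹ ^ 2 * I * I_sq, re_ofReal_mul, I_mul_re]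
    nlinarith
  · intro y
    simp only [← hfun (fun a => qPochInf a (dualNome b) ^ 2), ← hfun (entireBlock (dualNome b))]
    have hg := gauss_ne_zero (y + I * b⁻¹)
    have hw := vVar_ne_zero b (-y)
    rw [← gauss_add_I_mul_inv b y, uVar_neg_add_I_mul_inv hb, vVar_neg_add_I_mul_inv hb,
      ← entireBlock_step hq']
    field_simp
    ring

/-! ### Position of the zeros of `dualTheta` relative to the contour. -/

theorem eq_half_add_of_dualTheta_eq_zero {b : ℂ} (hbr : 0 < b.re) (him : 0 < (b ^ 2).im)
    {s t : ℝ} (h : dualTheta b (s * (I * b) + t * (I * b⁻¹)) = 0) :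
    ∃ j l : ℤ, s = 1 / 2 + j ∧ t = 1 / 2 + l := by
  have hb := ne_zero_of_re_pos hbr
  have hinv := im_inv_sq_neg him
  obtain ⟨j, l, hjl⟩ := (dualTheta_eq_zero_iff hb him _).mp h
  have e : (s : ℂ) * (I * b) + t * (I * b⁻¹) =
      ((1 / 2 + j : ℝ) : ℂ) * (I * b) + ((1 / 2 + l : ℝ) : ℂ) * (I * b⁻¹) := by
    rw [hjl, cb]; push_cast; ring
  refine ⟨j, l, ?_, ?_⟩
  · have h1 := congrArg (fun x => ‖uVar b x‖) e
    simp only [uVar_coords hb, Real.exp_eq_exp] at h1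
    have h2 : -(2 * Real.pi * (b ^ 2).im) ≠ 0 :=
      neg_ne_zero.mpr (mul_pos Real.two_pi_pos him).ne'
    linarith [mul_left_cancel₀ h2 h1]
  · have h1 := congrArg (fun x => ‖vVar b x‖) e
    simp only [vVar_coords hb, Real.exp_eq_exp] at h1
    have h2 : 2 * Real.pi * ((b ^ 2)⁻¹).im ≠ 0 :=
      (mul_neg_of_pos_of_neg Real.two_pi_pos hinv).ne
    linarith [mul_left_cancel₀ h2 h1]

theorem ne_half_add_int {s : ℝ} (h0 : 0 < s) (h1 : s < 1 / 2) (j : ℤ) : s ≠ 1 / 2 + j := by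
  intro h
  have h2 : (-1 : ℝ) < j := by linarith
  have h3 : (j : ℝ) < 0 := by linarith
  have h4 : (-1 : ℤ) < j := by exact_mod_cast h2
  have h5 : j < 0 := by exact_mod_cast h3
  omega

/-- Zeros have both lattice coordinates in 1/2 + ℤ, whereas the edges through the vertex have one
coordinate equal to r/2, strictly between 0 and 1/2. Quasi-periodicity transfers this to the
opposite edges. -/
theorem dualTheta_edge_ne_zero {b : ℂ} (hbr : 0 < b.re) (him : 0 < (b ^ 2).im) {r : ℝ}
    (hr0 : 0 < r) (hr1 : r < 1) (t : ℝ) :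
    dualTheta b (r * cb b + t * (I * b⁻¹)) ≠ 0 ∧
    dualTheta b (r * cb b + t * (I * b⁻¹) + I * b) ≠ 0 ∧
    dualTheta b (r * cb b + t * (I * b)) ≠ 0 ∧
    dualTheta b (r * cb b + t * (I * b) + I * b⁻¹) ≠ 0 := by
  have hb := ne_zero_of_re_pos hbr
  have h1 : dualTheta b (r * cb b + t * (I * b⁻¹)) ≠ 0 := by
    intro h
    rw [mul_cb_eq, add_assoc, ← add_mul, ← ofReal_add] at h
    obtain ⟨j, l, hj, _⟩ := eq_half_add_of_dualTheta_eq_zero hbr him h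
    exact ne_half_add_int (by linarith) (by linarith) j hj
  have h2 : dualTheta b (r * cb b + t * (I * b)) ≠ 0 := by
    intro h
    rw [mul_cb_eq, add_right_comm, ← add_mul, ← ofReal_add] at h
    obtain ⟨j, l, _, hl⟩ := eq_half_add_of_dualTheta_eq_zero hbr him h
    exact ne_half_add_int (by linarith) (by linarith) l hl
  refine ⟨h1, ?_, h2, ?_⟩
  · rwa [dualTheta_add_I_mul hb]
  · rw [dualTheta_add_I_mul_inv hb him]
    exact mul_ne_zero (inv_ne_zero (neg_ne_zero.mpr (vVar_ne_zero _ _))) h2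

theorem continuousOn_blockIntegrand {b : ℂ} (him : 0 < (b ^ 2).im) :
    ContinuousOn (blockIntegrand b) {x | dualTheta b x ≠ 0} := by
  have h1 := differentiable_entireBlock (norm_nome_lt_one him)
  have h2 := differentiable_entireBlock (norm_dualNome_lt_one him)
  have h3 : Differentiable ℂ fun x => vVar b (-x) := (differentiable_vVar b).comp differentiable_neg
  exact (((differentiable_gauss.mul (h1.comp (differentiable_uVar b))).mul
    (h2.comp h3)).continuous.continuousOn).div
      ((differentiable_dualTheta him).pow 2).continuous.continuousOn fun x hx => pow_ne_zero 2 hx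

/-- The state integral along `ℝ + iε` is the integral of `blockIntegrand` along the boundary of the
parallelogram with vertex `(ε / Im c_b) c_b` and sides `ib`, `ib⁻¹`. -/
theorem stateIntegral_eq_boundary {b : ℂ} (hbr : 0 < b.re) (him : 0 < (b ^ 2).im) {ε : ℝ}
    (hε0 : 0 < ε) (hε1 : ε < (cb b).im) :
    Integrable (fun t : ℝ => stateIntegrand 1 2 b (t + I * ε)) ∧
    stateIntegral 1 2 b ε = ∫ t in (0 : ℝ)..1,
      boundaryIntegrand (blockIntegrand b) ((ε / (cb b).im : ℝ) * cb b) (I * b) (I * b⁻¹) t := by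
  have hb := ne_zero_of_re_pos hbr
  have hcb : 0 < (cb b).im := hε0.trans hε1
  have hq := norm_nome_lt_one him
  set r := ε / (cb b).im with hr
  have hr0 : 0 < r := div_pos hε0 hcb
  have hr1 : r < 1 := (div_lt_one hcb).mpr hε1
  set P : ℂ := r * cb b with hP
  have hPim : P.im = ε := by
    rw [hP, im_ofReal_mul, hr]; field_simp
  obtain ⟨hLi, hL⟩ := integral_left hbr him hr0 hr1 hcb
  obtain ⟨hRi, hR⟩ := integral_right hbr him hr0 hr1 hcb
  obtain ⟨K, hK⟩ := exists_inversion hbr him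
  rw [← hP] at hLi hL hRi hR
  set f : ℂ → ℂ := stateIntegrand 1 2 b with hf
  have hedge := dualTheta_edge_ne_zero hbr him hr0 hr1
  rw [← hP] at hedge
  have hUP : ‖uVar b (-P)‖ < 1 := by
    rw [hP, mul_cb_eq, uVar_neg_coords hb, Real.exp_lt_one_iff]
    have h1 : 0 < 1 / 2 - r / 2 := by linarith
    have := mul_pos (mul_pos Real.two_pi_pos him) h1
    linarith
  have hUt : ∀ t : ℝ, 0 < t → ‖uVar b (-(P + t * 1))‖ < 1 := by
    intro t ht
    have e : uVar b (-(P + t * 1)) = uVar b (-P) * exp (((-(2 * Real.pi * t) : ℝ) : ℂ) * b) := by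
      rw [uVar, uVar, ← Complex.exp_add]
      congr 1
      push_cast
      ring
    rw [e, norm_mul, Complex.norm_exp, re_ofReal_mul]
    have h1 : Real.exp (-(2 * Real.pi * t) * b.re) ≤ 1 := by
      rw [Real.exp_le_one_iff]
      have := mul_pos (mul_pos Real.two_pi_pos ht) hbr
      linarith
    nlinarith [norm_nonneg (uVar b (-P)), Real.exp_pos (-(2 * Real.pi * t) * b.re)]
  -- The inversion relation squared. It is applied with Y = (q̃/v;q̃)_∞² to the integrand and with Y
  -- = D(q̃,q̃/v) on the edge, so K² enters and leaves again.
  have hinvK : ∀ x Y : ℂ, dualTheta b x ≠ 0 → ‖uVar b (-x)‖ < 1 →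
      gauss x * qPochInf (uVar b x) (nome b) ^ 2 * Y / dualTheta b x ^ 2 =
        K ^ 2 * ((gauss x)⁻¹ * Y / qPochInf (uVar b (-x)) (nome b) ^ 2) := by
    intro x Y hx hu
    have h1 := hK x hx
    have h2 := qPochInf_ne_zero_of_norm_lt_one hq hu
    have h3 := gauss_ne_zero x
    field_simp
    linear_combination Y * (gauss x * (qPochInf (uVar b x) (nome b) *
      qPochInf (uVar b (-x)) (nome b)) + K * dualTheta b x) * h1
  have hfθ : ∀ x, dualTheta b x ≠ 0 → f x = gauss x * qPochInf (uVar b x) (nome b) ^ 2 *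
      qPochInf (vVar b (-x)) (dualNome b) ^ 2 / dualTheta b x ^ 2 := by
    intro x hx
    rw [hf, stateIntegrand_one_two hb]
    have h1 := hx
    rw [dualTheta, mul_ne_zero_iff] at h1
    obtain ⟨h1, h2⟩ := h1
    rw [dualTheta]
    field_simp
  have hcount : {t : ℝ | dualTheta b (P + t * 1) = 0}.Countable := by
    refine (Set.countable_range fun p : ℤ × ℤ =>
      (cb b + p.1 * (I * b) + p.2 * (I * b⁻¹) - P).re).mono ?_
    intro t ht
    obtain ⟨j, l, hjl⟩ := (dualTheta_eq_zero_iff hb him _).mp ht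
    exact ⟨(j, l), by simp [← hjl]⟩
  -- The inversion relation is available only off the zeros of θ, which are countable and so
  -- negligible on the line.
  have hae : ∀ᵐ t : ℝ, dualTheta b (P + t * 1) ≠ 0 := by
    simp only [ae_iff, ne_eq, not_not]
    exact hcount.measure_zero volume
  have hRae : ∀ᵐ t : ℝ ∂(volume.restrict (Set.Ioi (0 : ℝ))), f (P + t * 1) =
      K ^ 2 * ((gauss (P + t * 1))⁻¹ * qPochInf (vVar b (-(P + t * 1))) (dualNome b) ^ 2 /
        qPochInf (uVar b (-(P + t * 1))) (nome b) ^ 2) := by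
    filter_upwards [ae_restrict_of_ae hae, ae_restrict_mem measurableSet_Ioi] with t h1 h2
    rw [hfθ _ h1, hinvK _ _ h1 (hUt t h2)]
  have hfR : IntegrableOn (fun t : ℝ => f (P + t * 1)) (Set.Ioi 0) :=
    (Integrable.congr (hRi.const_mul (K ^ 2)) (hRae.mono fun t ht => ht.symm))
  have hneg : MeasurableEmbedding (fun t : ℝ => -t) := (Homeomorph.neg ℝ).measurableEmbedding
  have hfL : IntegrableOn (fun t : ℝ => f (P + t * 1)) (Set.Iic 0) := by
    rw [integrableOn_Iic_iff_integrableOn_Iio,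
      ← (Measure.measurePreserving_neg volume).integrableOn_comp_preimage hneg]
    have : (fun t : ℝ => -t) ⁻¹' Set.Iio 0 = Set.Ioi 0 := by ext t; simp
    change IntegrableOn (fun t : ℝ => f (P + ((-t : ℝ) : ℂ) * 1)) _
    rw [this]
    refine hLi.congr_fun (fun t _ => ?_) measurableSet_Ioi
    simp
  have hfI : Integrable (fun t : ℝ => f (P + t * 1)) := by
    rw [← integrableOn_univ, ← Set.Iic_union_Ioi (a := (0 : ℝ))]
    exact hfL.union hfR
  -- Since Im P = ε, the contour passes through P and a real translation moves the cut to t = 0.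
  have hshift : ∀ t : ℝ, f (t + I * ε) = f (P + ((t - P.re : ℝ) : ℂ) * 1) := by
    intro t
    congr 1
    apply Complex.ext <;> simp [hPim]
  refine ⟨?_, ?_⟩
  · simp only [hshift]
    exact hfI.comp_sub_right P.re
  rw [stateIntegral]
  simp only [← hf, hshift]
  rw [integral_sub_right_eq_self (fun t : ℝ => f (P + t * 1)) P.re,
    ← intervalIntegral.integral_Iic_add_Ioi hfL hfR]
  have hLval : ∫ t in Set.Iic (0 : ℝ), f (P + t * 1) = -∫ t in (0 : ℝ)..1,
      (blockIntegrand b (P + t * (I * b)) - blockIntegrand b (P + t * (I * b) + I * b⁻¹)) *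
        (I * b) := by
    have h1 := integral_comp_neg_Ioi (0 : ℝ) fun t : ℝ => f (P + t * 1)
    rw [neg_zero] at h1
    rw [← h1]
    have h2 : ∫ t in Set.Ioi (0 : ℝ), f (P + t * (-1)) * (-1) =
        -∫ t in Set.Ioi (0 : ℝ), f (P + ((-t : ℝ) : ℂ) * 1) := by
      rw [← integral_neg]
      congr 1
      ext t
      simp
    rw [← neg_eq_iff_eq_neg, ← h2, hL]
    refine intervalIntegral.integral_congr fun t _ => ?_
    have h3 := (hedge t).2.2.1
    rw [blockIntegrand_sub_add_I_mul_inv hb him]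
    have h4 := h3
    rw [dualTheta, mul_ne_zero_iff] at h4
    obtain ⟨h4, h5⟩ := h4
    rw [dualTheta]
    generalize P + (t : ℂ) * (I * b) = x at h4 h5 ⊢
    field_simp
  have hRval : ∫ t in Set.Ioi (0 : ℝ), f (P + t * 1) = ∫ t in (0 : ℝ)..1,
      (blockIntegrand b (P + t * (I * b⁻¹)) - blockIntegrand b (P + t * (I * b⁻¹) + I * b)) *
        (I * b⁻¹) := by
    rw [integral_congr_ae hRae, integral_const_mul]
    simp only [mul_one] at hR ⊢
    rw [hR, ← intervalIntegral.integral_const_mul]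
    refine intervalIntegral.integral_congr fun t _ => ?_
    have h3 := (hedge t).1
    have h6 : ‖uVar b (-(P + t * (I * b⁻¹)))‖ < 1 := by
      rw [← uVar_add_I_mul_inv hb] at hUP
      rw [hP, mul_cb_eq, add_assoc, ← add_mul, ← ofReal_add, uVar_neg_coords hb]
      rwa [uVar_add_I_mul_inv hb, hP, mul_cb_eq, uVar_neg_coords hb] at hUP
    rw [blockIntegrand_sub_add_I_mul hb him, hinvK _ _ h3 h6]
    ring
  have hcont := continuousOn_blockIntegrand him
  rw [hLval, hRval, neg_add_eq_sub, ← intervalIntegral.integral_sub]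
  · rfl
  · refine ContinuousOn.intervalIntegrable (ContinuousOn.mul (ContinuousOn.sub
      (hcont.comp (by fun_prop) fun t _ => (hedge t).1)
      (hcont.comp (by fun_prop) fun t _ => (hedge t).2.1)) continuousOn_const)
  · refine ContinuousOn.intervalIntegrable (ContinuousOn.mul (ContinuousOn.sub
      (hcont.comp (by fun_prop) fun t _ => (hedge t).2.2.1)
      (hcont.comp (by fun_prop) fun t _ => (hedge t).2.2.2)) continuousOn_const)

/-! ### Evaluation of the boundary integral by the residue at `c_b` -/

theorem convex_norm_exp_mul_lt (γ γ₀ : ℂ) {d : ℂ} (hd : d ≠ 0) :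
    Convex ℝ {x : ℂ | ‖exp (γ * x + γ₀) * d‖ < 1} := by
  have h := convex_norm_exp_lt γ (γ₀ + log d)
  simpa only [← add_assoc, Complex.exp_add _ (log d), exp_log hd] using h

/-- A convex neighbourhood of the period parallelogram in which `blockIntegrand` has no pole other
than `c_b`. -/
def cell (b : ℂ) : Set ℂ :=
  {x | ‖vVar b x * dualNome b‖ < 1} ∩ {x | ‖vVar b (-x)‖ < 1} ∩
    ({x | ‖uVar b x‖ < 1} ∩ {x | ‖uVar b (-x) * nome b‖ < 1})

theorem convex_cell (b : ℂ) : Convex ℝ (cell b) := by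
  refine ((convex_norm_exp_mul_lt _ _ (dualNome_ne_zero b)).inter ?_).inter
    ((convex_norm_exp_lt _ _).inter ?_)
  · exact (convex_norm_exp_lt (2 * Real.pi * b⁻¹) (-(Real.pi * I * (1 + (b ^ 2)⁻¹)))).neg
  · exact (convex_norm_exp_mul_lt (2 * Real.pi * b) (Real.pi * I * (b ^ 2 + 1))
      (nome_ne_zero b)).neg

theorem isOpen_cell (b : ℂ) : IsOpen (cell b) := by
  have h1 := (differentiable_uVar b).continuous
  have h2 := (differentiable_vVar b).continuous
  exact ((isOpen_norm_lt_one (h2.mul continuous_const)).inter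
    (isOpen_norm_lt_one (h2.comp continuous_neg))).inter
    ((isOpen_norm_lt_one h1).inter
      (isOpen_norm_lt_one ((h1.comp continuous_neg).mul continuous_const)))

theorem mem_cell_iff {b : ℂ} (hbr : 0 < b.re) (him : 0 < (b ^ 2).im) (s t : ℝ) :
    (s : ℂ) * (I * b) + t * (I * b⁻¹) ∈ cell b ↔ (t < 3 / 2 ∧ -(1 / 2) < t) ∧
      (-(1 / 2) < s ∧ s < 3 / 2) := by
  have hb := ne_zero_of_re_pos hbr
  have hB : 0 < 2 * Real.pi * (b ^ 2).im := mul_pos Real.two_pi_pos him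
  have hB' : 0 < -(2 * Real.pi * ((b ^ 2)⁻¹).im) := by
    have := mul_neg_of_pos_of_neg Real.two_pi_pos (im_inv_sq_neg him)
    linarith
  simp only [cell, Set.mem_inter_iff, Set.mem_ofPred_eq, norm_mul, uVar_coords hb, vVar_coords hb,
    uVar_neg_coords hb, vVar_neg_coords hb, norm_nome, norm_dualNome, ← Real.exp_add,
    Real.exp_lt_one_iff]
  refine and_congr (and_congr ?_ ?_) (and_congr ?_ ?_)
  · rw [show 2 * Real.pi * ((b ^ 2)⁻¹).im * (1 / 2 - t) + 2 * Real.pi * ((b ^ 2)⁻¹).im =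
      -(-(2 * Real.pi * ((b ^ 2)⁻¹).im) * (3 / 2 - t)) by ring, neg_lt_zero,
      mul_pos_iff_of_pos_left hB', sub_pos]
  · rw [show 2 * Real.pi * ((b ^ 2)⁻¹).im * (1 / 2 + t) =
      -(-(2 * Real.pi * ((b ^ 2)⁻¹).im) * (t - -(1 / 2))) by ring, neg_lt_zero,
      mul_pos_iff_of_pos_left hB', sub_pos]
  · rw [show -(2 * Real.pi * (b ^ 2).im) * (s + 1 / 2) =
      -((2 * Real.pi * (b ^ 2).im) * (s - -(1 / 2))) by ring, neg_lt_zero,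
      mul_pos_iff_of_pos_left hB, sub_pos]
  · rw [show -(2 * Real.pi * (b ^ 2).im) * (1 / 2 - s) + -(2 * Real.pi * (b ^ 2).im) =
      -((2 * Real.pi * (b ^ 2).im) * (3 / 2 - s)) by ring, neg_lt_zero,
      mul_pos_iff_of_pos_left hB, sub_pos]

theorem cb_mem_cell {b : ℂ} (hbr : 0 < b.re) (him : 0 < (b ^ 2).im) : cb b ∈ cell b := by
  have := mul_cb_eq b 1
  rw [ofReal_one, one_mul] at this
  rw [this, mem_cell_iff hbr him]
  norm_num

/-- From |v| = 1 the second coordinate is 1/2; the first lies in 1/2 + ℤ and strictly between -1/2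
and 3/2, so it is also 1/2. -/
theorem eq_cb_of_mem_cell {b x : ℂ} (hbr : 0 < b.re) (him : 0 < (b ^ 2).im) (hx : x ∈ cell b)
    (hv : 1 - vVar b x = 0) : x = cb b := by
  have hb := ne_zero_of_re_pos hbr
  have hr := norm_dualNome_lt_one him
  have hθ : dualTheta b x = 0 := by
    rw [dualTheta, qPochInf_step (vVar b x) hr, hv, zero_mul, zero_mul]
  obtain ⟨s, t, rfl⟩ := exists_lattice_coords hbr him x
  obtain ⟨j, l, hj, hl⟩ := eq_half_add_of_dualTheta_eq_zero hbr him hθ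
  obtain ⟨_, h1, h2⟩ := (mem_cell_iff hbr him s t).mp hx
  have hv' : ‖vVar b (s * (I * b) + t * (I * b⁻¹))‖ = 1 := by
    rw [← sub_eq_zero.mp hv, norm_one]
  rw [vVar_coords hb, Real.exp_eq_one_iff, mul_eq_zero, or_iff_right
    (mul_neg_of_pos_of_neg Real.two_pi_pos (im_inv_sq_neg him)).ne] at hv'
  have h3 : (-1 : ℝ) < j := by linarith
  have h4 : (j : ℝ) < 1 := by linarith
  have h5 : (-1 : ℤ) < j := by exact_mod_cast h3
  have h6 : j < 1 := by exact_mod_cast h4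
  have h7 : j = 0 := by omega
  rw [h7, Int.cast_zero, add_zero] at hj
  have ht : t = 1 / 2 := by linarith
  rw [hj, ht, cb]
  push_cast
  ring

/-- The numerator of `blockIntegrand` with respect to `(1 - v)²`. -/
noncomputable def blockNumerator (b x : ℂ) : ℂ :=
  gauss x * entireBlock (nome b) (uVar b x) * entireBlock (dualNome b) (vVar b (-x)) /
    (qPochInf (vVar b x * dualNome b) (dualNome b) * qPochInf (vVar b (-x)) (dualNome b)) ^ 2

theorem blockIntegrand_eq {b : ℂ} (him : 0 < (b ^ 2).im) (x : ℂ) :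
    blockIntegrand b x = blockNumerator b x / (1 - vVar b x) ^ 2 := by
  rw [blockIntegrand, dualTheta, qPochInf_step (vVar b x) (norm_dualNome_lt_one him),
    blockNumerator, div_div]
  ring_nf

theorem differentiableOn_blockNumerator {b : ℂ} (him : 0 < (b ^ 2).im) :
    DifferentiableOn ℂ (blockNumerator b) (cell b) := by
  have hr := norm_dualNome_lt_one him
  have h1 := differentiable_entireBlock (norm_nome_lt_one him)
  have h2 := differentiable_entireBlock hr
  have h3 : Differentiable ℂ fun x => vVar b (-x) := (differentiable_vVar b).comp differentiable_neg
  refine ((differentiable_gauss.mul (h1.comp (differentiable_uVar b))).mul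
    (h2.comp h3)).differentiableOn.div
      (((differentiable_qPochInf_comp hr ((differentiable_vVar b).mul_const (dualNome b))).mul
        (differentiable_qPochInf_comp hr h3)).pow 2).differentiableOn fun x hx => ?_
  exact pow_ne_zero 2 (mul_ne_zero (qPochInf_ne_zero_of_norm_lt_one hr hx.1.1)
    (qPochInf_ne_zero_of_norm_lt_one hr hx.1.2))

theorem vVar_add_real_mul {b : ℂ} (hb : b ≠ 0) (x : ℂ) (t : ℝ) :
    vVar b (x + t * (I * b)) = vVar b x * exp (2 * Real.pi * I * t) := by
  rw [vVar, vVar, ← Complex.exp_add]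
  congr 1
  field_simp
  ring

/-- The regular part integrates to 0 over the boundary, and the polar part k depends on v only. As v
is ib-periodic, the edges parallel to ib⁻¹ cancel; on the other two v runs once round circles of
radius less than 1 and greater than 1, which contribute A + B and 0. -/
theorem integral_boundary_blockIntegrand {b : ℂ} (hbr : 0 < b.re) (him : 0 < (b ^ 2).im) {r : ℝ}
    (hr0 : 0 < r) (hr1 : r < 1) :
    ∫ t in (0 : ℝ)..1, boundaryIntegrand (blockIntegrand b) (r * cb b) (I * b) (I * b⁻¹) t =
      -(I * b) * (blockNumerator b (cb b) -
        b / (2 * Real.pi) * deriv (blockNumerator b) (cb b)) := by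
  have hb := ne_zero_of_re_pos hbr
  have hp : (Real.pi : ℂ) ≠ 0 := ofReal_ne_zero.mpr Real.pi_ne_zero
  set P : ℂ := r * cb b with hP
  have hcell : cell b ∈ 𝓝 (cb b) := (isOpen_cell b).mem_nhds (cb_mem_cell hbr him)
  have hVd : HasDerivAt (fun x => 1 - vVar b x) (-(2 * Real.pi * b⁻¹)) (cb b) := by
    have := (deriv_vVar b (cb b)).const_sub 1
    rwa [vVar_cb hb, mul_one] at this
  obtain ⟨H, hH, hreg⟩ := exists_regular_part (V := fun x => 1 - vVar b x) hcell
    (differentiableOn_blockNumerator him)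
    ((differentiable_const (1 : ℂ)).sub (differentiable_vVar b)).differentiableOn
    (by rw [vVar_cb hb, sub_self]) (by rw [hVd.deriv]; simp [hp, hb])
    fun x hx hxc hv => hxc (eq_cb_of_mem_cell hbr him hx hv)
  rw [hVd.deriv] at hreg
  set A := blockNumerator b (cb b) with hA
  set B := deriv (blockNumerator b) (cb b) / -(2 * Real.pi * b⁻¹) with hB
  set k : ℂ → ℂ := fun x => A / (1 - vVar b x) ^ 2 + B / (1 - vVar b x) with hk
  have hmem : ∀ t : ℝ, 0 ≤ t → t ≤ 1 → P + t * (I * b⁻¹) ∈ cell b ∧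
      P + t * (I * b⁻¹) + I * b ∈ cell b ∧ P + t * (I * b) ∈ cell b ∧
        P + t * (I * b) + I * b⁻¹ ∈ cell b := by
    refine fun t ht ht' => mem_edges (fun s t hs0 hs1 ht0 ht1 => ?_) ht ht'
    · rw [hP, mul_cb_eq, show ((r / 2 : ℝ) : ℂ) * (I * b) + ((r / 2 : ℝ) : ℂ) * (I * b⁻¹) +
        s * (I * b) + t * (I * b⁻¹) = ((r / 2 + s : ℝ) : ℂ) * (I * b) +
          ((r / 2 + t : ℝ) : ℂ) * (I * b⁻¹) by push_cast; ring, mem_cell_iff hbr him]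
      refine ⟨⟨?_, ?_⟩, ?_, ?_⟩ <;> linarith
  have hθ : ∀ x, dualTheta b x ≠ 0 → 1 - vVar b x ≠ 0 := by
    intro x hx hv
    rw [dualTheta, qPochInf_step (vVar b x) (norm_dualNome_lt_one him), hv, zero_mul,
      zero_mul] at hx
    exact hx rfl
  have hedge := dualTheta_edge_ne_zero hbr him hr0 hr1
  rw [← hP] at hedge
  have hsplit : ∀ x ∈ cell b, dualTheta b x ≠ 0 → blockIntegrand b x = H x + k x := by
    intro x hx h
    rw [blockIntegrand_eq him]
    refine hreg x hx ?_
    rintro rfl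
    exact hθ _ h (by rw [vVar_cb hb, sub_self])
  have hsum : ∫ t in (0 : ℝ)..1, boundaryIntegrand (blockIntegrand b) P (I * b) (I * b⁻¹) t =
      ∫ t in (0 : ℝ)..1, (boundaryIntegrand H P (I * b) (I * b⁻¹) t +
        boundaryIntegrand k P (I * b) (I * b⁻¹) t) := by
    refine intervalIntegral.integral_congr fun t ht => ?_
    rw [Set.uIcc_of_le zero_le_one] at ht
    obtain ⟨m1, m2, m3, m4⟩ := hmem t ht.1 ht.2
    obtain ⟨n1, n2, n3, n4⟩ := hedge t
    simp only [boundaryIntegrand]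
    rw [hsplit _ m1 n1, hsplit _ m2 n2, hsplit _ m3 n3, hsplit _ m4 n4]
    ring
  have hkc : ContinuousOn k {x | dualTheta b x ≠ 0} := by
    have h1 : Continuous fun x => 1 - vVar b x :=
      continuous_const.sub (differentiable_vVar b).continuous
    exact (continuousOn_const.div (h1.pow 2).continuousOn fun x hx => pow_ne_zero 2 (hθ x hx)).add
      (continuousOn_const.div h1.continuousOn hθ)
  have hI : ∀ f : ℂ → ℂ, ContinuousOn (boundaryIntegrand f P (I * b) (I * b⁻¹)) (Set.Icc 0 1) →
      IntervalIntegrable (boundaryIntegrand f P (I * b) (I * b⁻¹)) volume 0 1 := by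
    intro f hf
    refine ContinuousOn.intervalIntegrable ?_
    rwa [Set.uIcc_of_le zero_le_one]
  rw [hsum, intervalIntegral.integral_add
    (hI H (continuousOn_boundaryIntegrand hH.continuousOn hmem))
    (hI k (continuousOn_boundaryIntegrand hkc fun t _ _ => hedge t)),
    integral_boundaryIntegrand_eq_zero (convex_cell b) (isOpen_cell b) hH
      hmem, zero_add]
  have hkval : ∀ t : ℝ, boundaryIntegrand k P (I * b) (I * b⁻¹) t =
      (A / (1 - vVar b (P + I * b⁻¹) * exp (2 * Real.pi * I * t)) ^ 2 +
        B / (1 - vVar b (P + I * b⁻¹) * exp (2 * Real.pi * I * t))) * (I * b) -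
      (A / (1 - vVar b P * exp (2 * Real.pi * I * t)) ^ 2 +
        B / (1 - vVar b P * exp (2 * Real.pi * I * t))) * (I * b) := by
    intro t
    simp only [boundaryIntegrand, hk]
    rw [vVar_add_I_mul hb, add_right_comm P, vVar_add_real_mul hb, vVar_add_real_mul hb]
    ring
  have hinv := mul_neg_of_pos_of_neg Real.two_pi_pos (im_inv_sq_neg him)
  have hv1 : ‖vVar b P‖ < 1 := by
    rw [hP, mul_cb_eq, vVar_coords hb, Real.exp_lt_one_iff]
    exact mul_neg_of_neg_of_pos hinv (by linarith)
  have hv2 : 1 < ‖vVar b (P + I * b⁻¹)‖ := by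
    rw [hP, mul_cb_eq, show ((r / 2 : ℝ) : ℂ) * (I * b) + ((r / 2 : ℝ) : ℂ) * (I * b⁻¹) +
      I * b⁻¹ = ((r / 2 : ℝ) : ℂ) * (I * b) + ((r / 2 + 1 : ℝ) : ℂ) * (I * b⁻¹) by
        push_cast; ring, vVar_coords hb, Real.one_lt_exp_iff]
    exact mul_pos_of_neg_of_neg hinv (by linarith)
  have hki : ∀ z : ℂ, ‖z‖ ≠ 1 → IntervalIntegrable (fun t : ℝ =>
      (A / (1 - z * exp (2 * Real.pi * I * t)) ^ 2 +
        B / (1 - z * exp (2 * Real.pi * I * t))) * (I * b)) volume 0 1 := by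
    intro z hz
    refine Continuous.intervalIntegrable ?_ 0 1
    have hc : Continuous fun t : ℝ => 1 - z * exp (2 * Real.pi * I * t) := by fun_prop
    have hne : ∀ t : ℝ, 1 - z * exp (2 * Real.pi * I * t) ≠ 0 := by
      intro t h
      have h1 := norm_mul_exp_two_pi z t
      rw [← sub_eq_zero.mp h, norm_one] at h1
      exact hz h1.symm
    exact ((continuous_const.div (hc.pow 2) fun t => pow_ne_zero 2 (hne t)).add
      (continuous_const.div hc hne)).mul continuous_const
  simp only [hkval]
  rw [intervalIntegral.integral_sub (hki _ hv2.ne') (hki _ hv1.ne),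
    intervalIntegral.integral_mul_const, intervalIntegral.integral_mul_const,
    integral_circle_of_one_lt_norm A B hv2, integral_circle_of_norm_lt_one A B hv1, hB]
  field_simp
  ring

/-! ### The residue in terms of g and G. -/

theorem deriv_uVar (b x : ℂ) : HasDerivAt (uVar b) (2 * Real.pi * b * uVar b x) x := by
  have := (((hasDerivAt_id x).const_mul (2 * Real.pi * b)).add_const
    (Real.pi * I * (b ^ 2 + 1))).cexp
  refine this.congr_deriv ?_
  rw [uVar]; simp; ring

theorem deriv_gauss (x : ℂ) : HasDerivAt gauss (-(2 * Real.pi * I) * x * gauss x) x := by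
  have := (((hasDerivAt_pow 2 x)).const_mul (-(Real.pi * I))).cexp
  refine this.congr_deriv ?_
  rw [gauss]; simp; ring

theorem residue_value {b : ℂ} (hbr : 0 < b.re) (him : 0 < (b ^ 2).im) :
    blockNumerator b (cb b) - b / (2 * Real.pi) * deriv (blockNumerator b) (cb b) =
      gauss (cb b) * qPochInf (nome b) (nome b) ^ 2 /
        (2 * qPochInf (dualNome b) (dualNome b) ^ 2) *
          (G41 (dualNome b) * g41 (nome b) - b ^ 2 * (G41 (nome b) * g41 (dualNome b))) := by
  have hb := ne_zero_of_re_pos hbr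
  have hq := norm_nome_lt_one him
  have hr := norm_dualNome_lt_one him
  have hp : (Real.pi : ℂ) ≠ 0 := ofReal_ne_zero.mpr Real.pi_ne_zero
  have hS := qPochInf_ne_zero_of_norm_lt_one hr hr
  have hv := deriv_vVar b (cb b)
  have hw : HasDerivAt (fun x => vVar b (-x)) (-(2 * Real.pi * b⁻¹ * dualNome b)) (cb b) := by
    have h := (deriv_vVar b (-cb b)).scomp (cb b) (hasDerivAt_neg (cb b))
    rw [vVar_neg_cb hb] at h
    exact h.congr_deriv (by simp)
  have hu := deriv_uVar b (cb b)
  have hg := deriv_gauss (cb b)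
  rw [vVar_cb hb, mul_one] at hv
  rw [uVar_cb hb] at hu
  have hD : HasDerivAt (fun x => entireBlock (nome b) (uVar b x))
      (deriv (entireBlock (nome b)) (nome b) * (2 * Real.pi * b * nome b)) (cb b) := by
    refine HasDerivAt.comp (h₂ := entireBlock (nome b)) (cb b) ?_ hu
    rw [uVar_cb hb]
    exact (differentiable_entireBlock hq _).hasDerivAt
  have hD' : HasDerivAt (fun x => entireBlock (dualNome b) (vVar b (-x)))
      (deriv (entireBlock (dualNome b)) (dualNome b) * (-(2 * Real.pi * b⁻¹ * dualNome b)))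
        (cb b) := by
    refine HasDerivAt.comp (h₂ := entireBlock (dualNome b)) (cb b) ?_ hw
    rw [vVar_neg_cb hb]
    exact (differentiable_entireBlock hr _).hasDerivAt
  have hT1 : HasDerivAt (fun x => qPochInf (vVar b x * dualNome b) (dualNome b))
      (deriv (fun a => qPochInf a (dualNome b)) (dualNome b) *
        (2 * Real.pi * b⁻¹ * dualNome b)) (cb b) := by
    refine HasDerivAt.comp (h₂ := fun a => qPochInf a (dualNome b)) (cb b) ?_ (hv.mul_const _)
    rw [vVar_cb hb, one_mul]
    exact (differentiable_qPochInf hr _).hasDerivAt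
  have hT2 : HasDerivAt (fun x => qPochInf (vVar b (-x)) (dualNome b))
      (deriv (fun a => qPochInf a (dualNome b)) (dualNome b) *
        (-(2 * Real.pi * b⁻¹ * dualNome b))) (cb b) := by
    refine HasDerivAt.comp (h₂ := fun a => qPochInf a (dualNome b)) (cb b) ?_ hw
    rw [vVar_neg_cb hb]
    exact (differentiable_qPochInf hr _).hasDerivAt
  -- The factors (q̃v;q̃)_∞ and (q̃/v;q̃)_∞ are exchanged by v ↦ 1/v, so their product is stationary
  -- at v = 1 and the denominator does not contribute to the derivative.
  have hT : HasDerivAt (fun x => (qPochInf (vVar b x * dualNome b) (dualNome b) *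
      qPochInf (vVar b (-x)) (dualNome b)) ^ 2) 0 (cb b) := by
    refine ((hT1.mul hT2).pow 2).congr_deriv ?_
    simp only [Pi.mul_apply, vVar_cb hb, vVar_neg_cb hb, one_mul]
    ring
  have hTne : (qPochInf (vVar b (cb b) * dualNome b) (dualNome b) *
      qPochInf (vVar b (-cb b)) (dualNome b)) ^ 2 ≠ 0 := by
    rw [vVar_cb hb, vVar_neg_cb hb, one_mul]
    exact pow_ne_zero 2 (mul_ne_zero hS hS)
  have hN : HasDerivAt (blockNumerator b) _ (cb b) := ((hg.mul hD).mul hD').div hT hTne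
  have e1 := self_mul_deriv_entireBlock hq
  have e2 := self_mul_deriv_entireBlock hr
  have e3 := entireBlock_self hq
  have e4 := entireBlock_self hr
  -- The logarithmic derivative of the Gaussian turns the undifferentiated term into (1 - b²)/2
  -- times the product of both blocks; its two halves complete the derivative of each block to the
  -- combination D + 2uD' that gives G.
  have hcb : b * (I * cb b) = -(b ^ 2 + 1) / 2 := by
    rw [cb]; field_simp; rw [I_sq]; ring
  rw [hN.deriv, blockNumerator]
  simp only [Pi.mul_apply, vVar_cb hb, vVar_neg_cb hb, uVar_cb hb, one_mul, mul_zero, sub_zero]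
  rw [show gauss (cb b) * qPochInf (nome b) (nome b) ^ 2 /
      (2 * qPochInf (dualNome b) (dualNome b) ^ 2) *
        (G41 (dualNome b) * g41 (nome b) - b ^ 2 * (G41 (nome b) * g41 (dualNome b))) =
      gauss (cb b) / (2 * qPochInf (dualNome b) (dualNome b) ^ 4) *
        ((qPochInf (dualNome b) (dualNome b) ^ 2 * G41 (dualNome b)) *
          (qPochInf (nome b) (nome b) ^ 2 * g41 (nome b)) -
        b ^ 2 * ((qPochInf (nome b) (nome b) ^ 2 * G41 (nome b)) *
          (qPochInf (dualNome b) (dualNome b) ^ 2 * g41 (dualNome b)))) by field_simp,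
    ← e1, ← e2, ← e3, ← e4]
  set S := qPochInf (dualNome b) (dualNome b)
  set D := entireBlock (nome b) (nome b)
  set D' := deriv (entireBlock (nome b)) (nome b)
  set E := entireBlock (dualNome b) (dualNome b)
  set E' := deriv (entireBlock (dualNome b)) (dualNome b)
  set c := cb b
  set γ := gauss c
  field_simp
  linear_combination 2 * γ * D * E * hcb

/-! ### The modular transformation of `(q;q)_∞` -/

theorem eta_eq_qPochInf (z : ℂ) : ModularForm.eta z = exp (2 * Real.pi * I * z / 24) *
    qPochInf (exp (2 * Real.pi * I * z)) (exp (2 * Real.pi * I * z)) := by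
  simp [ModularForm.eta, qPochInf, Function.Periodic.qParam, pow_succ']

theorem sq_csqrt (z : ℂ) : sqrt z ^ 2 = z := by
  have := Complex.cpow_nat_inv_pow z (n := 2) two_ne_zero
  simpa only [sqrt, Nat.cast_ofNat, one_div] using this

theorem gauss_cb {b : ℂ} (hb : b ≠ 0) :
    gauss (cb b) = I * exp (Real.pi * I / 4 * (b ^ 2 + (b ^ 2)⁻¹)) := by
  rw [← congrArg (· * exp (Real.pi * I / 4 * (b ^ 2 + (b ^ 2)⁻¹))) Complex.exp_pi_div_two_mul_I,
    ← Complex.exp_add, gauss, cb]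
  congr 1
  rw [mul_pow, div_pow, I_sq]
  field_simp
  ring

/-- The inversion η(-1/τ) at τ = b², squared so that no branch of the square root matters. The
Gaussian at c_b has phase i exp(πi(b² + b⁻²)/4); removing the eta prefactors, which account for
exp(πi(b² + b⁻²)/6), leaves (q/q̃)^{1/24}. -/
theorem qPochInf_sq_modular {b : ℂ} (hbr : 0 < b.re) (him : 0 < (b ^ 2).im) :
    gauss (cb b) * (b ^ 2 * qPochInf (nome b) (nome b) ^ 2) =
      -(nomeRatioPow b (1 / 24) * qPochInf (dualNome b) (dualNome b) ^ 2) := by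
  have hb := ne_zero_of_re_pos hbr
  have h := ModularForm.eta_comp_eq_csqrt_I_inv (show b ^ 2 ∈ UpperHalfPlane.upperHalfPlaneSet from him)
  simp only [Function.comp_apply, Pi.smul_apply, Pi.mul_apply, smul_eq_mul, eta_eq_qPochInf] at h
  rw [show 2 * (Real.pi : ℂ) * I * (-1 / b ^ 2) = -(2 * Real.pi * I * (b ^ 2)⁻¹) by ring] at h
  change exp (-(2 * Real.pi * I * (b ^ 2)⁻¹) / 24) * qPochInf (dualNome b) (dualNome b) =
    (sqrt I)⁻¹ * (sqrt (b ^ 2) * (exp (2 * Real.pi * I * b ^ 2 / 24) *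
      qPochInf (nome b) (nome b))) at h
  have h2 := congrArg (fun x => x ^ 2) h
  simp only [mul_pow, inv_pow, sq_csqrt, ← Complex.exp_nat_mul] at h2
  have e1 : gauss (cb b) = I * (nomeRatioPow b (1 / 24) *
      exp ((2 : ℕ) * (-(-(2 * Real.pi * I * (b ^ 2)⁻¹) / 24))) *
        exp ((2 : ℕ) * (2 * Real.pi * I * b ^ 2 / 24))) := by
    rw [gauss_cb hb, nomeRatioPow, ← Complex.exp_add, ← Complex.exp_add]
    congr 2
    push_cast
    ring
  have e2 : exp ((2 : ℕ) * (-(-(2 * (Real.pi : ℂ) * I * (b ^ 2)⁻¹) / 24))) *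
      exp ((2 : ℕ) * (-(2 * Real.pi * I * (b ^ 2)⁻¹) / 24)) = 1 := by
    rw [← Complex.exp_add, ← Complex.exp_zero]
    congr 1
    ring
  have hI : (I : ℂ)⁻¹ = -I := Complex.inv_I
  rw [hI] at h2
  rw [e1]
  linear_combination (nomeRatioPow b (1 / 24) *
    exp ((2 : ℕ) * (-(-(2 * Real.pi * I * (b ^ 2)⁻¹) / 24)))) * h2 -
    nomeRatioPow b (1 / 24) * qPochInf (dualNome b) (dualNome b) ^ 2 * e2

/-! ### The closed formula for the state integral. -/

theorem stateIntegral_eq {b : ℂ} (hbr : 0 < b.re) (him : 0 < (b ^ 2).im) {ε : ℝ}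
    (hε0 : 0 < ε) (hε1 : ε < (cb b).im) :
    stateIntegral 1 2 b ε = -(I / 2) * nomeRatioPow b (1 / 24) *
      (b * G41 (nome b) * g41 (dualNome b) - b⁻¹ * G41 (dualNome b) * g41 (nome b)) := by
  have hb := ne_zero_of_re_pos hbr
  have hr := norm_dualNome_lt_one him
  have hS := qPochInf_ne_zero_of_norm_lt_one hr hr
  have hcb : 0 < (cb b).im := hε0.trans hε1
  rw [(stateIntegral_eq_boundary hbr him hε0 hε1).2, integral_boundary_blockIntegrand hbr him
    (div_pos hε0 hcb) ((div_lt_one hcb).mpr hε1), residue_value hbr him]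
  have h := qPochInf_sq_modular hbr him
  field_simp
  linear_combination (-(G41 (dualNome b) * g41 (nome b) -
    b ^ 2 * (G41 (nome b) * g41 (dualNome b)))) * h

end KnotStateIntegral

theorem corollary1p6 :
    -- (a) the integral, on every contour between the real line and the first pole
    (∀ b : ℂ, 0 < b.re → 0 < (b ^ 2).im → ∀ ε : ℝ, 0 < ε → ε < (cb b).im →
      MeasureTheory.Integrable (fun t : ℝ => stateIntegrand 1 2 b (t + Complex.I * ε)) ∧
      stateIntegral 1 2 b ε =
        -(Complex.I / 2) * nomeRatioPow b (1 / 24) *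
          (b * G41 (nome b) * g41 (dualNome b) - b⁻¹ * G41 (dualNome b) * g41 (nome b))) ∧
    -- all series converge, and `F` is entire in `x`
    (∀ q : ℂ, ‖q‖ < 1 →
      (∀ x : ℂ, HasSum (fun n : ℕ => term41 q n * x ^ n) (seriesAB 1 2 q x)) ∧
      Differentiable ℂ (seriesAB 1 2 q) ∧
      (∀ x : ℂ, Summable (fun s : ℕ =>
        q ^ (s + 1) / (1 - q ^ (s + 1)) * seriesAB 1 2 q (q ^ (s + 1) * x))) ∧
      Summable (term41 q) ∧
      (∀ m : ℕ, Summable (fun s : ℕ => q ^ ((s + 1) * (m + 1)) / (1 - q ^ (s + 1)))) ∧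
      Summable (fun m : ℕ => weight41 q m * term41 q m)) ∧
    -- (b) `g = ⟨F⟩` and `G = ⟨(1 + 2δ - 4δ₁) F⟩`
    (∀ q : ℂ, ‖q‖ < 1 →
      g41 q = bracket (seriesAB 1 2 q) ∧
      G41 q = bracket (fun x => seriesAB 1 2 q x + 2 * opDelta (seriesAB 1 2 q) x
        - 4 * opDeltaK q 1 (seriesAB 1 2 q) x)) ∧
    -- (c) the `q`-difference equation, for functions and in `ℚ(q)[[x]]`
    (∀ q : ℂ, q ≠ 0 → ‖q‖ < 1 → ∀ x : ℂ,
      seriesAB 1 2 q (q⁻¹ * x) + seriesAB 1 2 q (q * x) = (2 - x) * seriesAB 1 2 q x) ∧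
    (PowerSeries.rescale (RatFunc.X : RatFunc ℚ)⁻¹ (formalAB 1 2 RatFunc.X) +
        PowerSeries.rescale (RatFunc.X : RatFunc ℚ) (formalAB 1 2 RatFunc.X) =
      (2 - PowerSeries.X) * formalAB 1 2 (RatFunc.X : RatFunc ℚ)) := by
  refine ⟨fun b hbr him ε hε0 hε1 => ⟨(stateIntegral_eq_boundary hbr him hε0 hε1).1,
    stateIntegral_eq hbr him hε0 hε1⟩, fun q hq => ⟨hasSum_seriesAB hq, differentiable_seriesAB hq,
    summable_opDeltaK_one hq, summable_term41 hq, summable_lambert hq,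
    (hasSum_weight41 hq).summable⟩, fun q hq => ⟨?_, (hasSum_weight41 hq).tsum_eq⟩,
    fun q hq0 hq x => seriesAB_qDifference hq0 hq x, formalAB_qDifference⟩
  simp [g41, bracket, seriesAB_one_two]
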